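/- **Setting.** Let $X\subseteq\mathbb R^n$ be compact, let $\Theta\subseteq\mathbb R^d$ be convex and relatively open, and for each $\theta\in\Theta$ let $\mathbb P_\theta$ be a probability measure on a measurable space $(\Omega,\mathcal F)$, with expectation $\mathbb E_\theta$. Let $c:X\times\Theta\to\mathbb R$ be bounded and uniformly continuous, and denote its continuous extension to $X\times\operatorname{cl}\Theta$ again by $c$. Let $\xi_1,\xi_2,\dots$ be random vectors in $\mathbb R^m$ and $\mathcal F_T=\sigma(\xi_1,\dots,\xi_T)$; below, $T$ ranges over $\{1,2,\dots\}$. *Statistic.* Let $\widehat S=\{\widehat S_T\}$ be an $\{\mathcal F_T\}$-adapted process with values in a closed set $\mathbb S\subseteq\mathbb R^d$, where $\mathbb S$ is the smallest closed set with $\mathbb P_\theta[\widehat S_T\in\mathbb S]=1$ for all $\theta\in\Theta$ and $T$. Let $S_\infty:\Theta\to\mathbb S$ be a local homeomorphism such that $\widehat S_T\to S_\infty(\theta)$ in $\mathbb P_\theta$-probability for all $\theta\in\Theta$. Put $\mathbb S_\infty=S_\infty(\Theta)$. Put $\Lambda_T(\lambda,\theta)=\log\mathbb E_\theta[\exp\langle\lambda,\widehat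 S_T\rangle]\in(-\infty,\infty]$. *Exponential family.* There are $\bar\theta\in\Theta$ and a continuous $g:\Theta\to\mathbb R^d$ such that, for all $T$ and $\theta\in\Theta$, $A_T(Tg(\theta))<\infty$, where $A_T=\Lambda_T(\cdot,\bar\theta)$, and the restrictions $\mathbb P_\theta^T$ of $\mathbb P_\theta$ to $\mathcal F_T$ satisfy $$\frac{\mathrm d\mathbb P^T_\theta}{\mathrm d\mathbb P^T_{\bar\theta}}=\exp\big(\langle Tg(\theta),\widehat S_T\rangle-A_T(Tg(\theta))\big).$$ *Gärtner–Ellis conditions.* $\Lambda_T(\lambda,\theta)<\infty$ for all $T$, $\lambda\in\mathbb R^d$, $\theta\in\Theta$; the limit $\Lambda(\lambda,\theta)=\lim_{T\to\infty}\frac1T\Lambda_T(T\lambda,\theta)$ exists as an extended real number for all $\lambda,\theta$; and for every $\theta\in\Theta$ the origin lies in the interior of $\operatorname{dom}\Lambda(\cdot,\theta)=\{\lambda:\Lambda(\lambda,\theta)<\infty\}$, $\Lambda(\cdot,\theta)$ is differentiable on that interior, and $\|\nabla_\lambda\Lambda(\lambda,\theta)\|\to\infty$ as $\lambda$ tends from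 the interior to a boundary point of the domain. *Regular rate function.* Let $I:\mathbb S\times\operatorname{cl}\Theta\to[0,\infty]$ be lower semi-continuous in $s$, with $I(s,\theta)=\sup_{\lambda\in\mathbb R^d}\{\langle\lambda,s\rangle-\Lambda(\lambda,\theta)\}$ for $s\in\mathbb S$, $\theta\in\Theta$, and assume that $I$ is regular: (i) $\operatorname{cl}\{\theta\in\Theta:I(s,\theta)<\rho\}=\{\theta\in\operatorname{cl}\Theta:I(s,\theta)\le\rho\}$ for all $s\in\mathbb S_\infty$, $\rho>0$; (ii) $I$ is continuous on $\mathbb S\times\Theta$; (iii) $\{(s,\theta)\in\mathbb S\times\operatorname{cl}\Theta:I(s,\theta)\le\rho\}$ is compact for every $\rho\ge0$. *Distributionally robust predictor and prescriptor.* Let $r>0$. For $x\in X$, $s\in\mathbb S$ put $\tilde c^\star(x,s)=\max\{c(x,\theta):\theta\in\operatorname{cl}\Theta,\ I(s,\theta)\le r\}$ if some $\theta\in\operatorname{cl}\Theta$ satisfies $I(s,\theta)\le r$, and $\tilde c^\star(x,s)=\sup_{\theta\in\operatorname{cl}\Theta}c(x,\theta)$ otherwise. Let $\tilde x^\star:\mathbb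 S\to X$ be any Borel measurable map that is quasi-continuous at every point of $\mathbb S_\infty$ (that is, for all neighbourhoods $U\subseteq\mathbb S$ of $s$ and $V$ of $\tilde x^\star(s)$ there is a non-empty open $W\subseteq U$ with $\tilde x^\star(W)\subseteq V$) and satisfies $\tilde x^\star(s)\in\arg\min_{x\in X}\tilde c^\star(x,s)$ for all $s\in\mathbb S$. Put $\widehat c^{\,\star}_T(x)=\tilde c^\star(x,\widehat S_T)$ and $\widehat x^\star_T=\tilde x^\star(\widehat S_T)$. *Data-driven pairs.* A data-driven predictor is a real-valued process $\widehat c=\{\widehat c_T(x)\}_{T,\,x\in X}$ such that $\widehat c_T(x)$ is continuous in $x$ and $\mathcal F_T$-measurable for each $x$; there is a non-negative random variable $\bar c$ with $\mathbb E_\theta[\bar c]<\infty$ and $|\widehat c_T(x)|\le\bar c$ $\mathbb P_\theta$-a.s. for all $T,x,\theta$; and there are Borel functions $c_\infty:X\times\Theta\to\mathbb R$ and $v_\infty:\Theta\to\mathbb R$ with $\widehat c_T(x)\to c_\infty(x,\theta)$ and $\min_{x\in X}\widehat c_T(x)\to v_\infty(\theta)$ in $\mathbb P_\theta$-probability for all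 $x,\theta$. Let $\widehat{\mathcal X}$ be the set of pairs $(\widehat c,\widehat x)$ of a data-driven predictor $\widehat c$ and an $\{\mathcal F_T\}$-adapted $X$-valued process $\widehat x$ with $\widehat x_T\in\arg\min_{x\in X}\widehat c_T(x)$ for all $T$. **Theorem (Optimality of $(\widehat c^{\,\star},\widehat x^\star)$).** Under the above assumptions, $(\widehat c^{\,\star},\widehat x^\star)$ is a Pareto dominant solution of the meta-optimization problem $$\min_{(\widehat c,\widehat x)\in\widehat{\mathcal X}}\ \Big\{\lim_{T\to\infty}\mathbb E_\theta[\widehat c_T(\widehat x_T)]\Big\}_{\theta\in\Theta}\quad\text{s.t.}\quad\limsup_{T\to\infty}\frac1T\log\mathbb P_\theta\big[c(\widehat x_T,\theta)>\widehat c_T(\widehat x_T)\big]\le-r\quad\forall\theta\in\Theta.$$ That is, $(\widehat c^{\,\star},\widehat x^\star)\in\widehat{\mathcal X}$ satisfies the constraint, and for every $(\widehat c,\widehat x)\in\widehat{\mathcal X}$ that satisfies the constraint and every $\theta\in\Theta$ both limits below exist and $$\lim_{T\to\infty}\mathbb E_\theta[\widehat c^{\,\star}_T(\widehat x^\star_T)]\le\lim_{T\to\infty}\mathbb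 E_\theta[\widehat c_T(\widehat x_T)].$$ -/

import Mathlib

open Set Filter Topology MeasureTheory
open scoped ENNReal NNReal RealInnerProductSpace

namespace DataDriven

noncomputable section

/-- Quasi-continuity of `f` at the point `x`. -/
def QuasiContinuousAt {A B : Type*} [TopologicalSpace A] [TopologicalSpace B]
    (f : A → B) (x : A) : Prop :=
  ∀ U ∈ 𝓝 x, ∀ V ∈ 𝓝 (f x), ∃ W : Set A, IsOpen W ∧ W.Nonempty ∧ W ⊆ U ∧ ∀ y ∈ W, f y ∈ V

variable {d n m : ℕ} {Ω : Type*} [MeasurableSpace Ω]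

/-- The `σ`-algebra generated by the observation history `(ξ₁, …, ξ_T)`. Time starts at `t = 1`. -/
abbrev history (ξ : ℕ → Ω → EuclideanSpace ℝ (Fin m)) (T : ℕ) : MeasurableSpace Ω :=
  ⨆ t ∈ Finset.Icc 1 T, MeasurableSpace.comap (ξ t) inferInstance

/-- A finitely parametrized ambiguity set `{P θ : θ ∈ Θ}`: the model space `Θ` is a relatively
open convex set and every `P θ`, `θ ∈ Θ`, is a probability measure (values of `P` off `Θ` play no
role). -/
structure IsParametrized (Θ : Set (EuclideanSpace ℝ (Fin d)))
    (P : EuclideanSpace ℝ (Fin d) → Measure Ω) : Prop where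
  convex : Convex ℝ Θ
  relOpen : intrinsicInterior ℝ Θ = Θ
  prob : ∀ θ ∈ Θ, IsProbabilityMeasure (P θ)

/-- The model-based predictor `c` is uniformly continuous and bounded on `X × Θ`. -/
structure IsRegularCost (X : Set (EuclideanSpace ℝ (Fin n))) (Θ : Set (EuclideanSpace ℝ (Fin d)))
    (c : EuclideanSpace ℝ (Fin n) → EuclideanSpace ℝ (Fin d) → ℝ) : Prop where
  unifCont : UniformContinuousOn (Function.uncurry c) (X ×ˢ Θ)
  bounded : ∃ M : ℝ, ∀ x ∈ X, ∀ θ ∈ Θ, |c x θ| ≤ M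

/-- The continuous extension of the model-based predictor from `X × Θ` to `X × cl Θ`. -/
def costExt (X : Set (EuclideanSpace ℝ (Fin n))) (Θ : Set (EuclideanSpace ℝ (Fin d)))
    (c : EuclideanSpace ℝ (Fin n) → EuclideanSpace ℝ (Fin d) → ℝ)
    (x : EuclideanSpace ℝ (Fin n)) (θ : EuclideanSpace ℝ (Fin d)) : ℝ :=
  extendFrom (X ×ˢ Θ) (Function.uncurry c) (x, θ)

/-- `S` is a statistic whose state space is the closed set `𝕊`, with limit map `Sinf : Θ → 𝕊`;
`𝕊` is the smallest closed set that supports all `S T`, `T ≥ 1`, under all models. -/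
structure IsStatistic (Θ : Set (EuclideanSpace ℝ (Fin d)))
    (P : EuclideanSpace ℝ (Fin d) → Measure Ω) (ξ : ℕ → Ω → EuclideanSpace ℝ (Fin m))
    (𝕊 : Set (EuclideanSpace ℝ (Fin d))) (S : ℕ → Ω → 𝕊) (Sinf : Θ → 𝕊) : Prop where
  closed : IsClosed 𝕊
  minimal : ∀ C : Set (EuclideanSpace ℝ (Fin d)), IsClosed C →
    (∀ T, 1 ≤ T → ∀ θ ∈ Θ, P θ {ω | (S T ω : EuclideanSpace ℝ (Fin d)) ∈ C} = 1) → 𝕊 ⊆ C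
  adapted : ∀ T, 1 ≤ T → Measurable[history ξ T] (S T)
  localHomeo : IsLocalHomeomorph Sinf
  tendsto : ∀ θ : Θ, TendstoInMeasure (P θ) S atTop (fun _ => Sinf θ)

/-- The log-moment generating function `Λ_T(l, θ) = log E_θ[exp ⟨l, S_T⟩]`, with value `⊤` if the
expectation is infinite. -/
def logMGF (P : EuclideanSpace ℝ (Fin d) → Measure Ω) {𝕊 : Set (EuclideanSpace ℝ (Fin d))}
    (S : ℕ → Ω → 𝕊) (T : ℕ) (l θ : EuclideanSpace ℝ (Fin d)) : EReal :=
  ENNReal.log (∫⁻ ω, ENNReal.ofReal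
    (Real.exp ⟪l, (S T ω : EuclideanSpace ℝ (Fin d))⟫) ∂(P θ))

/-- The limiting log-moment generating function `Λ(l, θ) = lim_T Λ_T(T l, θ) / T`. It is written as
an upper limit; that the limit exists is part of `GartnerEllis`. -/
def limLogMGF (P : EuclideanSpace ℝ (Fin d) → Measure Ω) {𝕊 : Set (EuclideanSpace ℝ (Fin d))}
    (S : ℕ → Ω → 𝕊) (l θ : EuclideanSpace ℝ (Fin d)) : EReal :=
  limsup (fun T : ℕ => logMGF P S T ((T : ℝ) • l) θ / (T : EReal)) atTop

/-- `{P θ : θ ∈ Θ}` is a time-homogeneous exponential family: on the history up to time `T`, the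
measure `P θ` has density `exp (⟨T g(θ), S_T⟩ - A_T(T g(θ)))` with respect to a baseline model
`P θ₀`, where `A_T = Λ_T(·, θ₀)` and `T g(θ)` lies in the domain of `A_T`. -/
def IsExponentialFamily (Θ : Set (EuclideanSpace ℝ (Fin d)))
    (P : EuclideanSpace ℝ (Fin d) → Measure Ω) (ξ : ℕ → Ω → EuclideanSpace ℝ (Fin m))
    {𝕊 : Set (EuclideanSpace ℝ (Fin d))} (S : ℕ → Ω → 𝕊) : Prop :=
  ∃ θ₀ ∈ Θ, ∃ g : EuclideanSpace ℝ (Fin d) → EuclideanSpace ℝ (Fin d), ContinuousOn g Θ ∧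
    ∀ T : ℕ, 1 ≤ T → ∀ θ ∈ Θ,
      logMGF P S T ((T : ℝ) • g θ) θ₀ < ⊤ ∧
      ∀ A : Set Ω, MeasurableSet[history ξ T] A →
        P θ A = ∫⁻ ω in A, ENNReal.ofReal
          (Real.exp (⟪(T : ℝ) • g θ, (S T ω : EuclideanSpace ℝ (Fin d))⟫
            - (logMGF P S T ((T : ℝ) • g θ) θ₀).toReal)) ∂(P θ₀)

/-- The effective domain of `Λ(·, θ)`. -/
def domLim (P : EuclideanSpace ℝ (Fin d) → Measure Ω) {𝕊 : Set (EuclideanSpace ℝ (Fin d))}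
    (S : ℕ → Ω → 𝕊) (θ : EuclideanSpace ℝ (Fin d)) : Set (EuclideanSpace ℝ (Fin d)) :=
  {l | limLogMGF P S l θ < ⊤}

/-- The conditions on the log-moment generating functions in the Gärtner–Ellis theorem. -/
structure GartnerEllis (Θ : Set (EuclideanSpace ℝ (Fin d)))
    (P : EuclideanSpace ℝ (Fin d) → Measure Ω) {𝕊 : Set (EuclideanSpace ℝ (Fin d))}
    (S : ℕ → Ω → 𝕊) : Prop where
  finite : ∀ T : ℕ, 1 ≤ T → ∀ l, ∀ θ ∈ Θ, logMGF P S T l θ < ⊤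
  limit : ∀ l, ∀ θ ∈ Θ, Tendsto (fun T : ℕ => logMGF P S T ((T : ℝ) • l) θ / (T : EReal)) atTop
    (𝓝 (limLogMGF P S l θ))
  zero_mem : ∀ θ ∈ Θ, (0 : EuclideanSpace ℝ (Fin d)) ∈ interior (domLim P S θ)
  differentiable : ∀ θ ∈ Θ, ∀ l ∈ interior (domLim P S θ),
    DifferentiableAt ℝ (fun l' => (limLogMGF P S l' θ).toReal) l
  steep : ∀ θ ∈ Θ, ∀ l ∈ frontier (domLim P S θ),
    Tendsto (fun l' => ‖gradient (fun l'' => (limLogMGF P S l'' θ).toReal) l'‖)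
      (𝓝[interior (domLim P S θ)] l) atTop

/-- On `𝕊 × Θ`, the function `I` is the convex conjugate of `Λ(·, θ)`. -/
def IsConjugateOn (Θ : Set (EuclideanSpace ℝ (Fin d)))
    (P : EuclideanSpace ℝ (Fin d) → Measure Ω) {𝕊 : Set (EuclideanSpace ℝ (Fin d))}
    (S : ℕ → Ω → 𝕊) (I : 𝕊 → EuclideanSpace ℝ (Fin d) → ℝ≥0∞) : Prop :=
  ∀ s : 𝕊, ∀ θ ∈ Θ, ((I s θ : ℝ≥0∞) : EReal) =
    ⨆ l : EuclideanSpace ℝ (Fin d),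
      ((⟪l, (s : EuclideanSpace ℝ (Fin d))⟫ : ℝ) : EReal) - limLogMGF P S l θ

/-- `I : 𝕊 × cl Θ → [0, ∞]` is a regular rate function (values of `I s θ` for `θ ∉ cl Θ` play no
role); `range Sinf` is the set of asymptotic realizations of the statistic. -/
structure IsRegularRate (Θ : Set (EuclideanSpace ℝ (Fin d)))
    {𝕊 : Set (EuclideanSpace ℝ (Fin d))} (Sinf : Θ → 𝕊)
    (I : 𝕊 → EuclideanSpace ℝ (Fin d) → ℝ≥0∞) : Prop where
  lsc : ∀ θ ∈ closure Θ, LowerSemicontinuous (fun s => I s θ)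
  radial : ∀ s ∈ range Sinf, ∀ r : ℝ, 0 < r →
    closure {θ | θ ∈ Θ ∧ I s θ < ENNReal.ofReal r} =
      {θ | θ ∈ closure Θ ∧ I s θ ≤ ENNReal.ofReal r}
  continuousOn : ContinuousOn (Function.uncurry I) (univ ×ˢ Θ)
  levelCompact : ∀ r : ℝ, 0 ≤ r →
    IsCompact {p : 𝕊 × EuclideanSpace ℝ (Fin d) |
      p.2 ∈ closure Θ ∧ I p.1 p.2 ≤ ENNReal.ofReal r}

/-- The distributionally robust predictor: the worst-case cost over the `I`-ball of radius `r`
around `s`, or over all of `cl Θ` if this ball is empty. -/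
def robustPredictor (X : Set (EuclideanSpace ℝ (Fin n))) (Θ : Set (EuclideanSpace ℝ (Fin d)))
    (c : EuclideanSpace ℝ (Fin n) → EuclideanSpace ℝ (Fin d) → ℝ)
    {𝕊 : Set (EuclideanSpace ℝ (Fin d))} (I : 𝕊 → EuclideanSpace ℝ (Fin d) → ℝ≥0∞) (r : ℝ)
    (x : EuclideanSpace ℝ (Fin n)) (s : 𝕊) : ℝ :=
  open Classical in
  if ∃ θ ∈ closure Θ, I s θ ≤ ENNReal.ofReal r then
    sSup (costExt X Θ c x '' {θ | θ ∈ closure Θ ∧ I s θ ≤ ENNReal.ofReal r})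
  else sSup (costExt X Θ c x '' closure Θ)

/-- `xt : 𝕊 → X` is a (Borel measurable) distributionally robust prescriptor: it is quasi-continuous
on the set of asymptotic realizations and selects minimizers of the robust predictor. -/
structure IsRobustPrescriptor (X : Set (EuclideanSpace ℝ (Fin n)))
    (Θ : Set (EuclideanSpace ℝ (Fin d)))
    (c : EuclideanSpace ℝ (Fin n) → EuclideanSpace ℝ (Fin d) → ℝ)
    {𝕊 : Set (EuclideanSpace ℝ (Fin d))} (Sinf : Θ → 𝕊)
    (I : 𝕊 → EuclideanSpace ℝ (Fin d) → ℝ≥0∞) (r : ℝ)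
    (xt : 𝕊 → EuclideanSpace ℝ (Fin n)) : Prop where
  measurable : Measurable xt
  mem : ∀ s, xt s ∈ X
  quasiCont : ∀ s ∈ range Sinf, QuasiContinuousAt xt s
  isMin : ∀ s, IsMinOn (fun x => robustPredictor X Θ c I r x s) X (xt s)

/-- Data-driven predictors `ch T x ω`, for sample sizes `T ≥ 1` and decisions `x ∈ X`. -/
structure IsPredictor (X : Set (EuclideanSpace ℝ (Fin n))) (Θ : Set (EuclideanSpace ℝ (Fin d)))
    (P : EuclideanSpace ℝ (Fin d) → Measure Ω) (ξ : ℕ → Ω → EuclideanSpace ℝ (Fin m))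
    (ch : ℕ → EuclideanSpace ℝ (Fin n) → Ω → ℝ) : Prop where
  continuous : ∀ T, 1 ≤ T → ∀ ω, ContinuousOn (fun x => ch T x ω) X
  adapted : ∀ T, 1 ≤ T → ∀ x ∈ X, Measurable[history ξ T] (ch T x)
  dominated : ∃ cbar : Ω → ℝ, Measurable cbar ∧ (∀ ω, 0 ≤ cbar ω) ∧
    (∀ θ ∈ Θ, Integrable cbar (P θ)) ∧
    ∀ T, 1 ≤ T → ∀ x ∈ X, ∀ θ ∈ Θ, ∀ᵐ ω ∂(P θ), |ch T x ω| ≤ cbar ω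
  tendsto_objective : ∃ cinf : X → Θ → ℝ, Measurable (Function.uncurry cinf) ∧
    ∀ (x : X) (θ : Θ), TendstoInMeasure (P θ) (fun T => ch T x) atTop (fun _ => cinf x θ)
  tendsto_value : ∃ vinf : Θ → ℝ, Measurable vinf ∧
    ∀ θ : Θ, TendstoInMeasure (P θ) (fun T ω => sInf ((fun x => ch T x ω) '' X)) atTop
      (fun _ => vinf θ)

/-- Data-driven predictor–prescriptor pairs: `xh` is an adapted `X`-valued process that is induced
by the data-driven predictor `ch`. -/
structure IsPair (X : Set (EuclideanSpace ℝ (Fin n))) (Θ : Set (EuclideanSpace ℝ (Fin d)))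
    (P : EuclideanSpace ℝ (Fin d) → Measure Ω) (ξ : ℕ → Ω → EuclideanSpace ℝ (Fin m))
    (ch : ℕ → EuclideanSpace ℝ (Fin n) → Ω → ℝ) (xh : ℕ → Ω → EuclideanSpace ℝ (Fin n)) :
    Prop where
  predictor : IsPredictor X Θ P ξ ch
  adapted : ∀ T, 1 ≤ T → Measurable[history ξ T] (xh T)
  mem : ∀ T, 1 ≤ T → ∀ ω, xh T ω ∈ X
  induced : ∀ T, 1 ≤ T → ∀ ω, IsMinOn (fun x => ch T x ω) X (xh T ω)

/-- Feasibility in the meta-optimization problem over predictor–prescriptor pairs: under every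
model the prescription disappointment decays at exponential rate at least `r`. Here
`expGrowthSup u = limsup_T (log (u T)) / T`. -/
structure IsFeasible (X : Set (EuclideanSpace ℝ (Fin n))) (Θ : Set (EuclideanSpace ℝ (Fin d)))
    (P : EuclideanSpace ℝ (Fin d) → Measure Ω) (ξ : ℕ → Ω → EuclideanSpace ℝ (Fin m))
    (c : EuclideanSpace ℝ (Fin n) → EuclideanSpace ℝ (Fin d) → ℝ) (r : ℝ)
    (ch : ℕ → EuclideanSpace ℝ (Fin n) → Ω → ℝ) (xh : ℕ → Ω → EuclideanSpace ℝ (Fin n)) :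
    Prop where
  pair : IsPair X Θ P ξ ch xh
  rate : ∀ θ ∈ Θ,
    ExpGrowth.expGrowthSup (fun T => P θ {ω | ch T (xh T ω) ω < c (xh T ω) θ}) ≤ ((-r : ℝ) : EReal)

/-- `v` is the asymptotic expected in-sample risk `lim_T E_θ[ch_T(xh_T)]` of the pair. -/
def HasAsymptoticRisk (P : EuclideanSpace ℝ (Fin d) → Measure Ω)
    (ch : ℕ → EuclideanSpace ℝ (Fin n) → Ω → ℝ) (xh : ℕ → Ω → EuclideanSpace ℝ (Fin n))
    (θ : EuclideanSpace ℝ (Fin d)) (v : ℝ) : Prop :=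
  (∀ T, 1 ≤ T → Integrable (fun ω => ch T (xh T ω) ω) (P θ)) ∧
    Tendsto (fun T => ∫ ω, ch T (xh T ω) ω ∂(P θ)) atTop (𝓝 v)

/-- Pareto dominant solutions of the meta-optimization problem: feasible pairs whose asymptotic
in-sample risk is, simultaneously for all models, at most that of every other feasible pair. The
existence of these limits is part of the claim. -/
def IsParetoDominant (X : Set (EuclideanSpace ℝ (Fin n))) (Θ : Set (EuclideanSpace ℝ (Fin d)))
    (P : EuclideanSpace ℝ (Fin d) → Measure Ω) (ξ : ℕ → Ω → EuclideanSpace ℝ (Fin m))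
    (c : EuclideanSpace ℝ (Fin n) → EuclideanSpace ℝ (Fin d) → ℝ) (r : ℝ)
    (ch : ℕ → EuclideanSpace ℝ (Fin n) → Ω → ℝ) (xh : ℕ → Ω → EuclideanSpace ℝ (Fin n)) : Prop :=
  IsFeasible X Θ P ξ c r ch xh ∧
  ∀ ch' xh', IsFeasible X Θ P ξ c r ch' xh' → ∀ θ ∈ Θ, ∃ v v' : ℝ,
    HasAsymptoticRisk P ch xh θ v ∧ HasAsymptoticRisk P ch' xh' θ v' ∧ v ≤ v'

end

end DataDriven

namespace DataDriven

variable {d n m : ℕ} {Ω : Type*} [MeasurableSpace Ω]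

/-! Everything rests on `I (Sinf θ) θ = 0` and on two opposite exponential estimates.

Feasibility. If the ball around the observed statistic is empty, or if it contains `θ`, the robust
cost is at least the true cost. Disappointment under `θ` thus forces the statistic into the compact
set where the ball is non-empty and `I s θ ≥ r`. Chernoff's bound on half-spaces and a finite cover
give this set probability of rate at most `-r` (`expGrowthSup_measure_le_of_isCompact`).

Optimality. Suppose a feasible pair has values tending to `v` under `θ`, with `v < b` and `b` below
the minimal robust cost at `s = Sinf θ`. By regularity of `I`, each decision `x` has a model `θ'` in
`Θ` with `I s θ' < r` and `c x θ' > b`, and the second inequality persists near `x`. A value below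
`b` with a decision near `x` is therefore a disappointment under `θ'`, of rate at most `-r` there.
In an exponential family, near `s`, passing from `θ'` to `θ` costs a factor of rate at most `I s
θ'`, up to an arbitrarily small slack, so this event vanishes under `θ`
(`tendsto_measure_zero_of_expGrowthSup_le`). Finitely many such neighbourhoods cover `X`, so values
below `b` become improbable, contradicting convergence to `v`.

The limits exist because the values converge in probability and are dominated. For the robust pair
this needs its optimal value to be continuous at `Sinf θ`
(`IsRobustPrescriptor.continuousAt_value`). -/

theorem history_le {ξ : ℕ → Ω → EuclideanSpace ℝ (Fin m)} (hξ : ∀ t, 1 ≤ t → Measurable (ξ t))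
    (T : ℕ) : history ξ T ≤ (inferInstance : MeasurableSpace Ω) :=
  iSup₂_le fun t ht => (hξ t (Finset.mem_Icc.1 ht).1).comap_le

/-- The scaled exponential moment `E_θ[exp ⟨T l, S_T⟩]`. -/
noncomputable def expMoment (P : EuclideanSpace ℝ (Fin d) → Measure Ω)
    {𝕊 : Set (EuclideanSpace ℝ (Fin d))} (S : ℕ → Ω → 𝕊) (l θ : EuclideanSpace ℝ (Fin d))
    (T : ℕ) : ℝ≥0∞ :=
  ∫⁻ ω, ENNReal.ofReal
    (Real.exp ⟪(T : ℝ) • l, (S T ω : EuclideanSpace ℝ (Fin d))⟫) ∂(P θ)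

/-! ### Large deviations and change of measure -/

section LargeDeviations

variable {Θ : Set (EuclideanSpace ℝ (Fin d))} {P : EuclideanSpace ℝ (Fin d) → Measure Ω}
  {ξ : ℕ → Ω → EuclideanSpace ℝ (Fin m)} {𝕊 : Set (EuclideanSpace ℝ (Fin d))}
  {S : ℕ → Ω → 𝕊} {Sinf : Θ → 𝕊} {I : 𝕊 → EuclideanSpace ℝ (Fin d) → ℝ≥0∞}

/-- Existence of the limit turns the upper limit in the definition into a lower one, so exponential
moments can also be bounded from below. -/
theorem limLogMGF_eq_expGrowthInf (hGE : GartnerEllis Θ P S) (l : EuclideanSpace ℝ (Fin d))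
    {θ : EuclideanSpace ℝ (Fin d)} (hθ : θ ∈ Θ) :
    limLogMGF P S l θ = ExpGrowth.expGrowthInf (expMoment P S l θ) :=
  (hGE.limit l θ hθ).liminf_eq.symm

theorem exp_coe_mul_natCast (b : ℝ) (T : ℕ) :
    EReal.exp ((b : EReal) * (T : EReal)) = ENNReal.ofReal (Real.exp (b * T)) := by
  rw [← EReal.exp_coe]; norm_cast

theorem eventually_expMoment_le {l θ : EuclideanSpace ℝ (Fin d)} {b : ℝ}
    (h : limLogMGF P S l θ < b) :
    ∀ᶠ T : ℕ in atTop, expMoment P S l θ T ≤ ENNReal.ofReal (Real.exp (b * T)) := by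
  simpa only [exp_coe_mul_natCast] using
    ExpGrowth.eventually_le_exp (u := expMoment P S l θ) (a := b) h

theorem eventually_le_expMoment (hGE : GartnerEllis Θ P S) {l θ : EuclideanSpace ℝ (Fin d)}
    (hθ : θ ∈ Θ) {b : ℝ} (h : b < limLogMGF P S l θ) :
    ∀ᶠ T : ℕ in atTop, ENNReal.ofReal (Real.exp (b * T)) ≤ expMoment P S l θ T := by
  rw [limLogMGF_eq_expGrowthInf hGE l hθ] at h
  simpa only [exp_coe_mul_natCast] using ExpGrowth.eventually_exp_le h

theorem IsStatistic.measurable_coe (hS : IsStatistic Θ P ξ 𝕊 S Sinf) {T : ℕ} (hT : 1 ≤ T) :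
    Measurable[history ξ T] (fun ω => (S T ω : EuclideanSpace ℝ (Fin d))) :=
  measurable_subtype_coe.comp (hS.adapted T hT)

theorem IsStatistic.measurable_exp_inner (hS : IsStatistic Θ P ξ 𝕊 S Sinf) {T : ℕ} (hT : 1 ≤ T)
    (l : EuclideanSpace ℝ (Fin d)) (a : ℝ) :
    Measurable[history ξ T] (fun ω => ENNReal.ofReal
      (Real.exp (⟪l, (S T ω : EuclideanSpace ℝ (Fin d))⟫ - a))) := by
  have h : Continuous fun s : EuclideanSpace ℝ (Fin d) => ENNReal.ofReal
      (Real.exp (⟪l, s⟫ - a)) := ENNReal.continuous_ofReal.comp (by fun_prop)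
  exact h.measurable.comp (hS.measurable_coe hT)

/-- Chernoff's bound. -/
theorem eventually_measure_le_inner (hξ : ∀ t, 1 ≤ t → Measurable (ξ t))
    (hS : IsStatistic Θ P ξ 𝕊 S Sinf) {l θ : EuclideanSpace ℝ (Fin d)}
    {b : ℝ} (h : limLogMGF P S l θ < b) (a : ℝ) :
    ∀ᶠ T : ℕ in atTop, P θ {ω | a ≤ ⟪l, (S T ω : EuclideanSpace ℝ (Fin d))⟫} ≤
      ENNReal.ofReal (Real.exp ((b - a) * T)) := by
  filter_upwards [eventually_expMoment_le h, eventually_ge_atTop 1] with T hT hT1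
  have hmeas := (hS.measurable_exp_inner hT1 ((T : ℝ) • l) 0).mono (history_le hξ T) le_rfl
  simp only [sub_zero] at hmeas
  have hm := mul_meas_ge_le_lintegral₀ (μ := P θ) hmeas.aemeasurable
    (ENNReal.ofReal (Real.exp (a * T)))
  have hsub : {ω | a ≤ ⟪l, (S T ω : EuclideanSpace ℝ (Fin d))⟫} ⊆ {ω | ENNReal.ofReal
      (Real.exp (a * T)) ≤ ENNReal.ofReal
        (Real.exp ⟪(T : ℝ) • l, (S T ω : EuclideanSpace ℝ (Fin d))⟫)} := by
    intro ω hω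
    refine ENNReal.ofReal_le_ofReal (Real.exp_le_exp.2 ?_)
    rw [real_inner_smul_left, mul_comm]
    exact mul_le_mul_of_nonneg_left hω T.cast_nonneg
  calc P θ {ω | a ≤ ⟪l, (S T ω : EuclideanSpace ℝ (Fin d))⟫}
      = ENNReal.ofReal (Real.exp (-(a * T))) * (ENNReal.ofReal (Real.exp (a * T)) *
        P θ {ω | a ≤ ⟪l, (S T ω : EuclideanSpace ℝ (Fin d))⟫}) := by
        rw [← mul_assoc, ← ENNReal.ofReal_mul (Real.exp_nonneg _), ← Real.exp_add]
        simp
    _ ≤ ENNReal.ofReal (Real.exp (-(a * T))) * ENNReal.ofReal (Real.exp (b * T)) := by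
        gcongr
        exact (mul_le_mul_right (measure_mono hsub) _).trans (hm.trans hT)
    _ = _ := by
        rw [← ENNReal.ofReal_mul (Real.exp_nonneg _), ← Real.exp_add]
        ring_nf

theorem tendsto_ofReal_exp_mul {a : ℝ} (ha : a < 0) :
    Tendsto (fun T : ℕ => ENNReal.ofReal (Real.exp (a * T))) atTop (𝓝 0) := by
  have h : Tendsto (fun T : ℕ => Real.exp (a * T)) atTop (𝓝 0) :=
    Real.tendsto_exp_atBot.comp
      (tendsto_natCast_atTop_atTop.const_mul_atTop_of_neg ha)
  simpa using ENNReal.tendsto_ofReal h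

/-- Convergence in probability to a constant is convergence of the probabilities of
neighbourhoods. -/
theorem tendsto_measure_of_tendstoInMeasure_const {E : Type*} [PseudoMetricSpace E]
    {μ : Measure Ω} {f : ℕ → Ω → E} {a : E} (h : TendstoInMeasure μ f atTop fun _ => a)
    {U : Set E} (hU : U ∈ 𝓝 a) : Tendsto (fun T => μ {ω | f T ω ∉ U}) atTop (𝓝 0) := by
  obtain ⟨ε, hε, hU⟩ := EMetric.mem_nhds_iff.1 hU
  refine tendsto_of_tendsto_of_tendsto_of_le_of_le tendsto_const_nhds (h ε hε)
    (fun _ => zero_le) fun T => measure_mono fun ω hω => ?_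
  by_contra hlt
  exact hω (hU (Metric.mem_eball.2 (not_le.1 hlt)))

/-- As the limit is constant, continuity is needed at one point only; the robust predictor is shown
to be continuous only at points of `range Sinf`. -/
theorem TendstoInMeasure.comp_continuousAt {E F : Type*} [PseudoMetricSpace E]
    [PseudoMetricSpace F] {μ : Measure Ω} {f : ℕ → Ω → E} {a : E}
    (h : TendstoInMeasure μ f atTop fun _ => a) {φ : E → F} (hφ : ContinuousAt φ a) :
    TendstoInMeasure μ (fun T ω => φ (f T ω)) atTop fun _ => φ a := by
  refine tendstoInMeasure_iff_dist.2 fun ε hε => ?_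
  refine (tendsto_measure_of_tendstoInMeasure_const h
    (hφ (Metric.ball_mem_nhds _ hε))).congr fun T => ?_
  congr 1
  ext ω
  simp [mem_preimage, Metric.mem_ball]

/-- The limit of the statistic is a subgradient of the limiting log-moment generating function at
the origin. -/
theorem inner_le_limLogMGF (hP : IsParametrized Θ P) (hξ : ∀ t, 1 ≤ t → Measurable (ξ t))
    (hS : IsStatistic Θ P ξ 𝕊 S Sinf) (l : EuclideanSpace ℝ (Fin d)) (θ : Θ) :
    ((⟪l, (Sinf θ : EuclideanSpace ℝ (Fin d))⟫ : ℝ) : EReal) ≤ limLogMGF P S l θ := by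
  by_contra! hlt
  -- With `Λ < b < a < ⟪l, Sinf θ⟫`, Chernoff makes the half-space `a ≤ ⟪l, ·⟫` negligible, and
  -- convergence of the statistic makes its complement negligible: the total mass would vanish.
  obtain ⟨b, hb, hb'⟩ := EReal.lt_iff_exists_real_btwn.1 hlt
  obtain ⟨a, hba, ha⟩ := exists_between (EReal.coe_lt_coe_iff.1 hb')
  have h1 : Tendsto (fun T => P θ {ω | a ≤ ⟪l, (S T ω : EuclideanSpace ℝ (Fin d))⟫}) atTop
      (𝓝 0) :=
    tendsto_of_tendsto_of_tendsto_of_le_of_le' tendsto_const_nhds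
      (tendsto_ofReal_exp_mul (sub_neg.2 hba)) (Eventually.of_forall fun _ => zero_le)
      (eventually_measure_le_inner hξ hS hb a)
  have hU : {s : 𝕊 | a < ⟪l, (s : EuclideanSpace ℝ (Fin d))⟫} ∈ 𝓝 (Sinf θ) :=
    (isOpen_lt continuous_const (by fun_prop)).mem_nhds ha
  have h2 := tendsto_measure_of_tendstoInMeasure_const (hS.tendsto θ) hU
  have h3 := h1.add h2
  rw [add_zero] at h3
  have := hP.prob θ θ.2
  have h4 : (1 : ℝ≥0∞) ≤ 0 := ge_of_tendsto h3 <| Eventually.of_forall fun T => by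
    rw [← measure_univ (μ := P θ)]
    refine (measure_mono fun ω _ => ?_).trans (measure_union_le _ _)
    rcases lt_or_ge a ⟪l, (S T ω : EuclideanSpace ℝ (Fin d))⟫ with h | h
    · exact Or.inl h.le
    · exact Or.inr (not_lt.2 h)
  exact absurd h4 (by simp)

/-- Every term of the conjugate is non-positive at `Sinf θ`. Hence `θ` lies in the ball of every
statistic close to `Sinf θ`, which keeps these balls non-empty. -/
theorem IsConjugateOn.rate_limit_eq_zero (hI : IsConjugateOn Θ P S I) (hP : IsParametrized Θ P)
    (hξ : ∀ t, 1 ≤ t → Measurable (ξ t)) (hS : IsStatistic Θ P ξ 𝕊 S Sinf) (θ : Θ) :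
    I (Sinf θ) θ = 0 := by
  have h : ((I (Sinf θ) θ : ℝ≥0∞) : EReal) ≤ 0 := by
    rw [hI (Sinf θ) θ θ.2]
    refine iSup_le fun l => ?_
    rw [EReal.sub_nonpos]
    exact inner_le_limLogMGF hP hξ hS l θ
  exact le_antisymm (by exact_mod_cast h) zero_le

/-- Chernoff's bound in direction `l` at threshold `b + ρ` decays at rate `ρ`, and the strict
inequality makes the half-space a neighbourhood of `s`. -/
theorem exists_limLogMGF_lt (hI : IsConjugateOn Θ P S I) {θ : EuclideanSpace ℝ (Fin d)}
    (hθ : θ ∈ Θ) {s : 𝕊} {ρ : ℝ} (h : (ρ : EReal) < I s θ) :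
    ∃ l : EuclideanSpace ℝ (Fin d), ∃ b : ℝ, limLogMGF P S l θ < b ∧
      b + ρ < ⟪l, (s : EuclideanSpace ℝ (Fin d))⟫ := by
  rw [hI s θ hθ, lt_iSup_iff] at h
  obtain ⟨l, hl⟩ := h
  refine ⟨l, ?_⟩
  induction hΛ : limLogMGF P S l θ with
  -- Every real exceeds `⊥`, so `b` is chosen for the second inequality alone.
  | bot => exact ⟨⟪l, (s : EuclideanSpace ℝ (Fin d))⟫ - ρ - 1, EReal.bot_lt_coe _, by linarith⟩
  | coe x =>
    rw [hΛ] at hl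
    have hl' : ρ < ⟪l, (s : EuclideanSpace ℝ (Fin d))⟫ - x := by exact_mod_cast hl
    obtain ⟨b, hb, hb'⟩ := exists_between (show x < ⟪l, (s : EuclideanSpace ℝ (Fin d))⟫ - ρ by
      linarith)
    exact ⟨b, by exact_mod_cast hb, by linarith⟩
  | top =>
    rw [hΛ] at hl
    simp at hl

theorem expGrowthSup_le_of_le {u v : ℕ → ℝ≥0∞} (h : ∀ T, u T ≤ v T) :
    ExpGrowth.expGrowthSup u ≤ ExpGrowth.expGrowthSup v :=
  ExpGrowth.expGrowthSup_monotone h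

/-- The large deviation upper bound on compact sets. -/
theorem expGrowthSup_measure_le_of_isCompact (hξ : ∀ t, 1 ≤ t → Measurable (ξ t))
    (hS : IsStatistic Θ P ξ 𝕊 S Sinf) (hI : IsConjugateOn Θ P S I)
    {θ : EuclideanSpace ℝ (Fin d)} (hθ : θ ∈ Θ) {K : Set 𝕊} (hK : IsCompact K) {r : ℝ}
    (hKI : ∀ s ∈ K, ENNReal.ofReal r ≤ I s θ) :
    ExpGrowth.expGrowthSup (fun T => P θ {ω | S T ω ∈ K}) ≤ ((-r : ℝ) : EReal) := by
  refine EReal.le_of_forall_lt_iff_le.1 fun ρ' hρ' => ?_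
  obtain ⟨ρ, rfl⟩ : ∃ ρ : ℝ, ρ' = -ρ := ⟨-ρ', by simp⟩
  have hρ : ρ < r := by simpa using EReal.coe_lt_coe_iff.1 hρ'
  -- The growth rate of a sum is the maximum of the rates, so the bound survives finite unions and
  -- need only be proved locally.
  refine hK.induction_on (p := fun K => ExpGrowth.expGrowthSup (fun T => P θ {ω | S T ω ∈ K}) ≤
    ((-ρ : ℝ) : EReal)) ?_ ?_ ?_ ?_
  · refine (expGrowthSup_le_of_le (v := 0) fun T => by simp).trans ?_
    rw [ExpGrowth.expGrowthSup_zero]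
    exact bot_le
  · intro s t hst ht
    refine (expGrowthSup_le_of_le fun T => ?_).trans ht
    exact measure_mono fun ω hω => hst hω
  · intro s t hs ht
    refine (expGrowthSup_le_of_le (v := (fun T => P θ {ω | S T ω ∈ s}) +
      fun T => P θ {ω | S T ω ∈ t}) fun T => ?_).trans ?_
    · exact measure_union_le _ _
    rw [ExpGrowth.expGrowthSup_add]
    exact sup_le hs ht
  · intro s hs
    have hlt : (ρ : EReal) < I s θ := by
      refine lt_of_lt_of_le ?_ (EReal.coe_ennreal_le_coe_ennreal_iff.2 (hKI s hs))
      rw [EReal.coe_ennreal_ofReal]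
      exact_mod_cast hρ.trans_le (le_max_left _ _)
    obtain ⟨l, b, hb, hbl⟩ := exists_limLogMGF_lt hI hθ hlt
    refine ⟨{s' : 𝕊 | b + ρ < ⟪l, (s' : EuclideanSpace ℝ (Fin d))⟫}, mem_nhdsWithin_of_mem_nhds
      ((isOpen_lt continuous_const (by fun_prop)).mem_nhds hbl), ?_⟩
    refine Eventually.expGrowthSup_le ?_
    filter_upwards [eventually_measure_le_inner hξ hS hb (b + ρ)] with T hT
    rw [exp_coe_mul_natCast]
    refine (measure_mono fun ω hω => ?_).trans (hT.trans_eq (by ring_nf))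
    exact le_of_lt (show b + ρ < ⟪l, (S T ω : EuclideanSpace ℝ (Fin d))⟫ from hω)

/-- A density on a sub-`σ`-algebra computes the integrals of functions measurable with respect to
it. -/
theorem lintegral_eq_lintegral_mul_of_density {α : Type*} {hm m0 : MeasurableSpace α}
    (hle : hm ≤ m0) {μ ν : Measure α} {f : α → ℝ≥0∞}
    (hf : Measurable[hm] f) (h : ∀ A, MeasurableSet[hm] A → μ A = ∫⁻ ω in A, f ω ∂ν)
    {φ : α → ℝ≥0∞} (hφ : Measurable[hm] φ) : ∫⁻ ω, φ ω ∂μ = ∫⁻ ω, f ω * φ ω ∂ν := by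
  have htrim : μ.trim hle = (ν.withDensity f).trim hle := by
    refine @Measure.ext _ hm _ _ fun A hA => ?_
    rw [trim_measurableSet_eq hle hA, trim_measurableSet_eq hle hA, h A hA,
      withDensity_apply _ (hle A hA)]
  rw [← lintegral_trim hle hφ, htrim, lintegral_trim hle hφ,
    lintegral_withDensity_eq_lintegral_mul _ (hf.mono hle le_rfl) (hφ.mono hle le_rfl)]
  rfl

/-- Change of measure between two members of an exponential family. -/
theorem IsExponentialFamily.exists_expMoment_mul_eq (hexp : IsExponentialFamily Θ P ξ S)
    (hP : IsParametrized Θ P) (hξ : ∀ t, 1 ≤ t → Measurable (ξ t))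
    (hS : IsStatistic Θ P ξ 𝕊 S Sinf) {θ θ' : EuclideanSpace ℝ (Fin d)} (hθ : θ ∈ Θ)
    (hθ' : θ' ∈ Θ) : ∃ k : EuclideanSpace ℝ (Fin d), ∀ T : ℕ, 1 ≤ T → ∀ A : Set Ω,
      MeasurableSet[history ξ T] A → expMoment P S k θ T * P θ' A = ∫⁻ ω in A, ENNReal.ofReal
        (Real.exp ⟪(T : ℝ) • k, (S T ω : EuclideanSpace ℝ (Fin d))⟫) ∂(P θ) := by
  obtain ⟨θ₀, -, g, -, h⟩ := hexp
  -- The tilt is the difference of natural parameters, the same for all `T`.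
  refine ⟨g θ' - g θ, fun T hT => ?_⟩
  have hle := history_le hξ T
  set a := (logMGF P S T ((T : ℝ) • g θ) θ₀).toReal
  set a' := (logMGF P S T ((T : ℝ) • g θ') θ₀).toReal
  have key : ∀ A : Set Ω, MeasurableSet[history ξ T] A → ∫⁻ ω in A, ENNReal.ofReal
      (Real.exp ⟪(T : ℝ) • (g θ' - g θ), (S T ω : EuclideanSpace ℝ (Fin d))⟫) ∂(P θ) =
      ENNReal.ofReal (Real.exp (a' - a)) * P θ' A := by
    intro A hA
    have hm := hS.measurable_exp_inner hT ((T : ℝ) • (g θ' - g θ)) 0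
    simp only [sub_zero] at hm
    rw [← lintegral_indicator (hle A hA), lintegral_eq_lintegral_mul_of_density hle
      (hS.measurable_exp_inner hT ((T : ℝ) • g θ) a) (h T hT θ hθ).2 (hm.indicator hA),
      (h T hT θ' hθ').2 A hA, ← lintegral_const_mul _
      ((hS.measurable_exp_inner hT ((T : ℝ) • g θ') a').mono hle le_rfl),
      ← lintegral_indicator (hle A hA)]
    refine lintegral_congr fun ω => ?_
    by_cases hω : ω ∈ A
    · simp only [indicator_of_mem hω]
      rw [← ENNReal.ofReal_mul (Real.exp_nonneg _), ← ENNReal.ofReal_mul (Real.exp_nonneg _),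
        ← Real.exp_add, ← Real.exp_add]
      congr 2
      simp only [inner_sub_left, real_inner_smul_left]
      ring
    · simp [indicator_of_notMem hω]
  intro A hA
  -- The whole space identifies the constant `exp (a' - a)` with the exponential moment, which
  -- eliminates the baseline model.
  have huniv := key univ MeasurableSet.univ
  have := hP.prob θ' hθ'
  rw [measure_univ, mul_one, setLIntegral_univ] at huniv
  rw [key A hA, ← huniv, expMoment]

/-- Locally around the limit `s` of the statistic under `θ'`, probabilities under `θ'` exceed
those under `θ` at most by a factor with exponential rate `I s θ`. -/
theorem tendsto_measure_zero_of_expGrowthSup_le (hexp : IsExponentialFamily Θ P ξ S)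
    (hP : IsParametrized Θ P) (hξ : ∀ t, 1 ≤ t → Measurable (ξ t))
    (hS : IsStatistic Θ P ξ 𝕊 S Sinf) (hGE : GartnerEllis Θ P S) (hI : IsConjugateOn Θ P S I)
    {θ : EuclideanSpace ℝ (Fin d)} (hθ : θ ∈ Θ) (θ' : Θ) {r : ℝ}
    (hr : I (Sinf θ') θ < ENNReal.ofReal r) {A : ℕ → Set Ω}
    (hA : ∀ T, 1 ≤ T → MeasurableSet[history ξ T] (A T))
    (hrate : ExpGrowth.expGrowthSup (fun T => P θ (A T)) ≤ ((-r : ℝ) : EReal)) :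
    Tendsto (fun T => P θ' (A T)) atTop (𝓝 0) := by
  obtain ⟨k, hk⟩ := hexp.exists_expMoment_mul_eq hP hξ hS hθ θ'.2
  set s : EuclideanSpace ℝ (Fin d) := (Sinf θ' : EuclideanSpace ℝ (Fin d)) with hs
  obtain ⟨ρ, hIρ, hρr⟩ : ∃ ρ : ℝ, ((I (Sinf θ') θ : ℝ≥0∞) : EReal) < ρ ∧ ρ < r := by
    have hr' : ((I (Sinf θ') θ : ℝ≥0∞) : EReal) < (r : EReal) := by
      have h1 := EReal.coe_ennreal_lt_coe_ennreal_iff.2 hr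
      have h2 : 0 < r := ENNReal.ofReal_pos.1 (zero_le.trans_lt hr)
      rwa [EReal.coe_ennreal_ofReal, max_eq_left h2.le] at h1
    obtain ⟨ρ, h1, h2⟩ := EReal.lt_iff_exists_real_btwn.1 hr'
    exact ⟨ρ, h1, by exact_mod_cast h2⟩
  -- The conjugate at the single slope `k` gives `⟪k, s⟫ - Λ(k, θ) ≤ I s θ < ρ`, hence a lower bound
  -- for the normalising moment.
  have hΛ : ((⟪k, s⟫ - ρ : ℝ) : EReal) < limLogMGF P S k θ := by
    have h1 : ((⟪k, s⟫ : ℝ) : EReal) - limLogMGF P S k θ < ρ := by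
      refine lt_of_le_of_lt ?_ hIρ
      rw [hI (Sinf θ') θ hθ]
      exact le_iSup (fun l : EuclideanSpace ℝ (Fin d) =>
        ((⟪l, s⟫ : ℝ) : EReal) - limLogMGF P S l θ) k
    induction hΛ : limLogMGF P S k θ with
    | bot => simp [hΛ] at h1
    | coe x =>
      rw [hΛ] at h1
      have h2 : ⟪k, s⟫ - x < ρ := by exact_mod_cast h1
      exact EReal.coe_lt_coe_iff.2 (by linarith)
    | top => exact EReal.coe_lt_top _
  -- One `ε` is lost in bounding the tilt on the half-space `U`, the other in the rate of `A T`.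
  obtain ⟨ε, hε, hεr⟩ : ∃ ε > 0, ρ + 2 * ε < r := ⟨(r - ρ) / 3, by linarith, by linarith⟩
  set U : Set 𝕊 := {s' : 𝕊 | ⟪k, (s' : EuclideanSpace ℝ (Fin d))⟫ < ⟪k, s⟫ + ε} with hU
  have hUo : IsOpen U := isOpen_lt (by fun_prop) continuous_const
  have hUs : U ∈ 𝓝 (Sinf θ') := hUo.mem_nhds (show ⟪k, s⟫ < ⟪k, s⟫ + ε by linarith)
  have hout := tendsto_measure_of_tendstoInMeasure_const (hS.tendsto θ') hUs
  have hin : Tendsto (fun T => P θ' (A T ∩ S T ⁻¹' U)) atTop (𝓝 0) := by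
    have hA' : ExpGrowth.expGrowthSup (fun T => P θ (A T)) < ((-r + ε : ℝ) : EReal) :=
      hrate.trans_lt (EReal.coe_lt_coe_iff.2 (by linarith))
    refine tendsto_of_tendsto_of_tendsto_of_le_of_le' tendsto_const_nhds
      (tendsto_ofReal_exp_mul (a := ρ + 2 * ε - r) (by linarith))
      (Eventually.of_forall fun _ => zero_le) ?_
    filter_upwards [eventually_le_expMoment hGE hθ hΛ, ExpGrowth.eventually_le_exp hA',
      eventually_ge_atTop 1] with T hT1 hT2 hT
    rw [exp_coe_mul_natCast] at hT2
    have hmeas : MeasurableSet[history ξ T] (A T ∩ S T ⁻¹' U) :=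
      (hA T hT).inter (hS.adapted T hT hUo.measurableSet)
    have hbound : ENNReal.ofReal (Real.exp ((⟪k, s⟫ - ρ) * T)) * P θ' (A T ∩ S T ⁻¹' U) ≤
        ENNReal.ofReal (Real.exp ((⟪k, s⟫ + ε) * T)) *
          ENNReal.ofReal (Real.exp ((-r + ε) * T)) := by
      calc _ ≤ expMoment P S k θ T * P θ' (A T ∩ S T ⁻¹' U) := by gcongr
        _ = _ := hk T hT _ hmeas
        _ ≤ ∫⁻ ω in A T ∩ S T ⁻¹' U, ENNReal.ofReal (Real.exp ((⟪k, s⟫ + ε) * T)) ∂(P θ) := by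
          refine setLIntegral_mono' (history_le hξ T _ hmeas) fun ω hω => ?_
          refine ENNReal.ofReal_le_ofReal (Real.exp_le_exp.2 ?_)
          rw [real_inner_smul_left, mul_comm]
          exact mul_le_mul_of_nonneg_right (le_of_lt hω.2) T.cast_nonneg
        _ ≤ _ := by
          rw [setLIntegral_const]
          gcongr
          exact (measure_mono inter_subset_left).trans hT2
    calc P θ' (A T ∩ S T ⁻¹' U)
        = ENNReal.ofReal (Real.exp (-((⟪k, s⟫ - ρ) * T))) *
          (ENNReal.ofReal (Real.exp ((⟪k, s⟫ - ρ) * T)) * P θ' (A T ∩ S T ⁻¹' U)) := by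
          rw [← mul_assoc, ← ENNReal.ofReal_mul (Real.exp_nonneg _), ← Real.exp_add]
          simp
      _ ≤ _ := mul_le_mul_right hbound _
      _ = _ := by
        rw [← ENNReal.ofReal_mul (Real.exp_nonneg _), ← ENNReal.ofReal_mul (Real.exp_nonneg _),
          ← Real.exp_add, ← Real.exp_add]
        ring_nf
  have hsum := hin.add hout
  rw [add_zero] at hsum
  refine tendsto_of_tendsto_of_tendsto_of_le_of_le tendsto_const_nhds hsum
    (fun _ => zero_le) fun T => (measure_mono fun ω hω => ?_).trans (measure_union_le _ _)
  by_cases h : S T ω ∈ U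
  · exact Or.inl ⟨hω, h⟩
  · exact Or.inr h

end LargeDeviations

/-! ### The cost extended to the closure of the model space -/

section Cost

variable {X : Set (EuclideanSpace ℝ (Fin n))} {Θ : Set (EuclideanSpace ℝ (Fin d))}
  {c : EuclideanSpace ℝ (Fin n) → EuclideanSpace ℝ (Fin d) → ℝ}

/-- Uniform continuity maps the trace of the neighbourhood filter to a Cauchy filter. -/
theorem IsRegularCost.exists_tendsto (hc : IsRegularCost X Θ c)
    {x : EuclideanSpace ℝ (Fin n)} (hx : x ∈ X) {θ : EuclideanSpace ℝ (Fin d)}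
    (hθ : θ ∈ closure Θ) :
    ∃ y, Tendsto (Function.uncurry c) (𝓝[X ×ˢ Θ] (x, θ)) (𝓝 y) := by
  have hmem : (x, θ) ∈ closure (X ×ˢ Θ) := by
    rw [closure_prod_eq]; exact ⟨subset_closure hx, hθ⟩
  have : (𝓝[X ×ˢ Θ] (x, θ)).NeBot := mem_closure_iff_nhdsWithin_neBot.1 hmem
  have hcauchy : Cauchy (map (Function.uncurry c) (𝓝[X ×ˢ Θ] (x, θ))) := by
    refine ⟨inferInstance, ?_⟩
    rw [prod_map_map_eq]
    refine Tendsto.mono_left hc.unifCont (le_inf ?_ ?_)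
    · exact (Filter.prod_mono inf_le_left inf_le_left).trans
        (nhds_prod_eq.symm.le.trans (nhds_le_uniformity _))
    · rw [← prod_principal_principal]
      exact Filter.prod_mono inf_le_right inf_le_right
  exact CompleteSpace.complete hcauchy

theorem IsRegularCost.costExt_eq (hc : IsRegularCost X Θ c) {x : EuclideanSpace ℝ (Fin n)}
    (hx : x ∈ X) {θ : EuclideanSpace ℝ (Fin d)} (hθ : θ ∈ Θ) : costExt X Θ c x θ = c x θ :=
  extendFrom_eq (f := Function.uncurry c) (subset_closure ⟨hx, hθ⟩)
    (hc.unifCont.continuousOn (x, θ) ⟨hx, hθ⟩)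

theorem IsRegularCost.tendsto_costExt (hc : IsRegularCost X Θ c)
    {x : EuclideanSpace ℝ (Fin n)} (hx : x ∈ X) {θ : EuclideanSpace ℝ (Fin d)}
    (hθ : θ ∈ closure Θ) : Tendsto (c x) (𝓝[Θ] θ) (𝓝 (costExt X Θ c x θ)) := by
  have h := tendsto_extendFrom (hc.exists_tendsto hx hθ)
  have h' : Tendsto (fun θ' => (x, θ')) (𝓝[Θ] θ) (𝓝[X ×ˢ Θ] (x, θ)) :=
    tendsto_nhdsWithin_iff.2 ⟨(Continuous.prodMk_right x).continuousWithinAt,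
      eventually_nhdsWithin_of_forall fun _ h => ⟨hx, h⟩⟩
  exact h.comp h'

theorem IsRegularCost.continuousOn_costExt (hc : IsRegularCost X Θ c)
    {x : EuclideanSpace ℝ (Fin n)} (hx : x ∈ X) :
    ContinuousOn (costExt X Θ c x) (closure Θ) := by
  have h : ContinuousOn (extendFrom (X ×ˢ Θ) (Function.uncurry c)) (X ×ˢ closure Θ) := by
    refine continuousOn_extendFrom ?_ fun p hp => hc.exists_tendsto hp.1 hp.2
    rw [closure_prod_eq]
    exact Set.prod_mono subset_closure subset_rfl
  exact h.comp (Continuous.prodMk_right x).continuousOn fun θ hθ => ⟨hx, hθ⟩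

theorem IsRegularCost.exists_abs_costExt_le (hc : IsRegularCost X Θ c) :
    ∃ M : ℝ, 0 ≤ M ∧ ∀ x ∈ X, ∀ θ ∈ closure Θ, |costExt X Θ c x θ| ≤ M := by
  obtain ⟨M, hM⟩ := hc.bounded
  refine ⟨|M|, abs_nonneg _, fun x hx θ hθ => ?_⟩
  have := mem_closure_iff_nhdsWithin_neBot.1 hθ
  exact le_of_tendsto (hc.tendsto_costExt hx hθ).abs
    (eventually_nhdsWithin_of_forall fun θ' hθ' => (hM x hx θ' hθ').trans (le_abs_self M))

/-- The modulus does not depend on the model, so it survives a supremum over any set of models. -/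
theorem IsRegularCost.costExt_equicontinuous (hc : IsRegularCost X Θ c) {ε : ℝ} (hε : 0 < ε) :
    ∃ δ > 0, ∀ x ∈ X, ∀ x' ∈ X, dist x x' < δ → ∀ θ ∈ closure Θ,
      |costExt X Θ c x θ - costExt X Θ c x' θ| ≤ ε := by
  obtain ⟨δ, hδ, h⟩ := Metric.uniformContinuousOn_iff.1 hc.unifCont ε hε
  refine ⟨δ, hδ, fun x hx x' hx' hxx' θ hθ => ?_⟩
  have := mem_closure_iff_nhdsWithin_neBot.1 hθ
  refine le_of_tendsto ((hc.tendsto_costExt hx hθ).sub (hc.tendsto_costExt hx' hθ)).abs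
    (eventually_nhdsWithin_of_forall fun θ' hθ' => ?_)
  have h1 := h (x, θ') ⟨hx, hθ'⟩ (x', θ') ⟨hx', hθ'⟩ (by simpa [Prod.dist_eq, hδ] using hxx')
  rw [Real.dist_eq] at h1
  exact h1.le

end Cost

/-! ### Regularity of the robust predictor and its optimal value -/

section Robust

variable {X : Set (EuclideanSpace ℝ (Fin n))} {Θ : Set (EuclideanSpace ℝ (Fin d))}
  {c : EuclideanSpace ℝ (Fin n) → EuclideanSpace ℝ (Fin d) → ℝ}
  {𝕊 : Set (EuclideanSpace ℝ (Fin d))} {Sinf : Θ → 𝕊}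
  {I : 𝕊 → EuclideanSpace ℝ (Fin d) → ℝ≥0∞} {r : ℝ}

/-- The models over which the distributionally robust predictor maximizes. -/
def ambiguitySet (Θ : Set (EuclideanSpace ℝ (Fin d))) {𝕊 : Set (EuclideanSpace ℝ (Fin d))}
    (I : 𝕊 → EuclideanSpace ℝ (Fin d) → ℝ≥0∞) (r : ℝ) (s : 𝕊) :
    Set (EuclideanSpace ℝ (Fin d)) :=
  {θ | θ ∈ closure Θ ∧ ((∃ θ' ∈ closure Θ, I s θ' ≤ ENNReal.ofReal r) → I s θ ≤ ENNReal.ofReal r)}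

theorem ambiguitySet_nonempty (hΘ : Θ.Nonempty) (s : 𝕊) : (ambiguitySet Θ I r s).Nonempty := by
  by_cases h : ∃ θ' ∈ closure Θ, I s θ' ≤ ENNReal.ofReal r
  · obtain ⟨θ, hθ, hI⟩ := h
    exact ⟨θ, hθ, fun _ => hI⟩
  · obtain ⟨θ, hθ⟩ := hΘ
    exact ⟨θ, subset_closure hθ, fun h' => absurd h' h⟩

/-- The implication in `ambiguitySet` is vacuous for an empty ball, so both branches become one
supremum. -/
theorem robustPredictor_eq (x : EuclideanSpace ℝ (Fin n)) (s : 𝕊) :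
    robustPredictor X Θ c I r x s = sSup (costExt X Θ c x '' ambiguitySet Θ I r s) := by
  unfold robustPredictor ambiguitySet
  split_ifs with h
  · simp [h]
  · simp [h]

theorem IsRegularCost.bddAbove_image (hc : IsRegularCost X Θ c) {x : EuclideanSpace ℝ (Fin n)}
    (hx : x ∈ X) (s : 𝕊) : BddAbove (costExt X Θ c x '' ambiguitySet Θ I r s) := by
  obtain ⟨M, -, hM⟩ := hc.exists_abs_costExt_le
  refine ⟨M, ?_⟩
  rintro _ ⟨θ, hθ, rfl⟩
  exact (le_abs_self _).trans (hM x hx θ hθ.1)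

theorem IsRegularCost.le_robustPredictor (hc : IsRegularCost X Θ c)
    {x : EuclideanSpace ℝ (Fin n)} (hx : x ∈ X) {s : 𝕊} {θ : EuclideanSpace ℝ (Fin d)}
    (hθ : θ ∈ ambiguitySet Θ I r s) : costExt X Θ c x θ ≤ robustPredictor X Θ c I r x s := by
  rw [robustPredictor_eq]
  exact le_csSup (hc.bddAbove_image hx s) (mem_image_of_mem _ hθ)

theorem robustPredictor_le (hΘ : Θ.Nonempty) {x : EuclideanSpace ℝ (Fin n)} {s : 𝕊} {a : ℝ}
    (h : ∀ θ ∈ ambiguitySet Θ I r s, costExt X Θ c x θ ≤ a) :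
    robustPredictor X Θ c I r x s ≤ a := by
  rw [robustPredictor_eq]
  refine csSup_le ((ambiguitySet_nonempty hΘ s).image _) ?_
  rintro _ ⟨θ, hθ, rfl⟩
  exact h θ hθ

theorem exists_lt_costExt_of_lt_robustPredictor (hΘ : Θ.Nonempty)
    {x : EuclideanSpace ℝ (Fin n)} {s : 𝕊} {a : ℝ} (h : a < robustPredictor X Θ c I r x s) :
    ∃ θ ∈ ambiguitySet Θ I r s, a < costExt X Θ c x θ := by
  by_contra! h'
  exact absurd (robustPredictor_le hΘ h') (not_le.2 h)

theorem IsRegularCost.exists_abs_robustPredictor_le (hc : IsRegularCost X Θ c)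
    (hΘ : Θ.Nonempty) (I : 𝕊 → EuclideanSpace ℝ (Fin d) → ℝ≥0∞) (r : ℝ) :
    ∃ M : ℝ, 0 ≤ M ∧ ∀ x ∈ X, ∀ s, |robustPredictor X Θ c I r x s| ≤ M := by
  obtain ⟨M, hM0, hM⟩ := hc.exists_abs_costExt_le
  refine ⟨M, hM0, fun x hx s => abs_le.2 ⟨?_, ?_⟩⟩
  · obtain ⟨θ, hθ⟩ := ambiguitySet_nonempty (I := I) (r := r) hΘ s
    exact (abs_le.1 (hM x hx θ hθ.1)).1.trans (hc.le_robustPredictor hx hθ)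
  · exact robustPredictor_le hΘ fun θ hθ => (abs_le.1 (hM x hx θ hθ.1)).2

theorem IsRegularCost.robustPredictor_equicontinuous (hc : IsRegularCost X Θ c)
    (hΘ : Θ.Nonempty) (I : 𝕊 → EuclideanSpace ℝ (Fin d) → ℝ≥0∞) (r : ℝ) {ε : ℝ} (hε : 0 < ε) :
    ∃ δ > 0, ∀ x ∈ X, ∀ x' ∈ X, dist x x' < δ → ∀ s,
      |robustPredictor X Θ c I r x s - robustPredictor X Θ c I r x' s| ≤ ε := by
  obtain ⟨δ, hδ, h⟩ := hc.costExt_equicontinuous hε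
  have key : ∀ x ∈ X, ∀ x' ∈ X, dist x x' < δ → ∀ s : 𝕊,
      robustPredictor X Θ c I r x s ≤ robustPredictor X Θ c I r x' s + ε :=
    fun x hx x' hx' hd s => robustPredictor_le hΘ fun θ hθ => by
      linarith [(abs_le.1 (h x hx x' hx' hd θ hθ.1)).2,
        hc.le_robustPredictor (I := I) (r := r) hx' hθ]
  refine ⟨δ, hδ, fun x hx x' hx' hd s => abs_le.2 ⟨?_, ?_⟩⟩
  · linarith [key x' hx' x hx (by rwa [dist_comm]) s]
  · linarith [key x hx x' hx' hd s]

/-- A projection of a closed part of a compact level set of `I`. These sets act as superlevel sets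
of the predictor; their closedness yields measurability and upper semicontinuity. -/
theorem IsRegularRate.isCompact_setOf_le (hreg : IsRegularRate Θ Sinf I) (hr : 0 ≤ r)
    (hc : IsRegularCost X Θ c) {x : EuclideanSpace ℝ (Fin n)} (hx : x ∈ X) (a : ℝ) :
    IsCompact {s : 𝕊 | ∃ θ ∈ closure Θ, I s θ ≤ ENNReal.ofReal r ∧ a ≤ costExt X Θ c x θ} := by
  have hL := hreg.levelCompact r hr
  have hcont : ContinuousOn (fun p : 𝕊 × EuclideanSpace ℝ (Fin d) => costExt X Θ c x p.2)
      {p | p.2 ∈ closure Θ ∧ I p.1 p.2 ≤ ENNReal.ofReal r} :=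
    (hc.continuousOn_costExt hx).comp continuous_snd.continuousOn fun p hp => hp.1
  have hK := (hL.of_isClosed_subset
    (hcont.preimage_isClosed_of_isClosed hL.isClosed isClosed_Ici) inter_subset_left).image
    continuous_fst (s := _ ∩ _ ⁻¹' Ici a)
  convert hK using 1
  ext s
  constructor
  · rintro ⟨θ, h1, h2, h3⟩
    exact ⟨(s, θ), ⟨⟨h1, h2⟩, h3⟩, rfl⟩
  · rintro ⟨⟨s, θ⟩, ⟨⟨h1, h2⟩, h3⟩, rfl⟩
    exact ⟨θ, h1, h2, h3⟩

theorem IsRegularRate.isCompact_setOf_exists_le (hreg : IsRegularRate Θ Sinf I) (hr : 0 ≤ r) :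
    IsCompact {s : 𝕊 | ∃ θ ∈ closure Θ, I s θ ≤ ENNReal.ofReal r} := by
  convert (hreg.levelCompact r hr).image continuous_fst using 1
  ext s
  constructor
  · rintro ⟨θ, h1, h2⟩
    exact ⟨(s, θ), ⟨h1, h2⟩, rfl⟩
  · rintro ⟨⟨s, θ⟩, ⟨h1, h2⟩, rfl⟩
    exact ⟨θ, h1, h2⟩

theorem IsRegularRate.measurable_robustPredictor (hreg : IsRegularRate Θ Sinf I) (hr : 0 ≤ r)
    (hc : IsRegularCost X Θ c) (hΘ : Θ.Nonempty) {x : EuclideanSpace ℝ (Fin n)} (hx : x ∈ X) :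
    Measurable (robustPredictor X Θ c I r x) := by
  refine measurable_of_Ioi fun a => ?_
  -- Rational thresholds reduce the strict inequality to closed sets; where the ball is empty the
  -- condition no longer depends on `s`.
  have heq : robustPredictor X Θ c I r x ⁻¹' Ioi a =
      (⋃ q : {q : ℚ // a < q}, {s : 𝕊 | ∃ θ ∈ closure Θ, I s θ ≤ ENNReal.ofReal r ∧
        ((q : ℚ) : ℝ) ≤ costExt X Θ c x θ}) ∪
      ({s : 𝕊 | ∃ θ ∈ closure Θ, I s θ ≤ ENNReal.ofReal r}ᶜ ∩
        {_s | ∃ θ ∈ closure Θ, a < costExt X Θ c x θ}) := by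
    ext s
    constructor
    · intro hs
      obtain ⟨θ, hθ, hlt⟩ := exists_lt_costExt_of_lt_robustPredictor hΘ hs
      by_cases h : ∃ θ ∈ closure Θ, I s θ ≤ ENNReal.ofReal r
      · obtain ⟨q, hq, hq'⟩ := exists_rat_btwn hlt
        exact Or.inl (mem_iUnion.2 ⟨⟨q, hq⟩, θ, hθ.1, hθ.2 h, hq'.le⟩)
      · exact Or.inr ⟨h, θ, hθ.1, hlt⟩
    · rintro (hs | ⟨hs, θ, hθ, hlt⟩)
      · obtain ⟨⟨q, hq⟩, θ, hθ, hI, hqθ⟩ := mem_iUnion.1 hs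
        exact hq.trans_le (hqθ.trans (hc.le_robustPredictor hx ⟨hθ, fun _ => hI⟩))
      · exact lt_of_lt_of_le hlt (hc.le_robustPredictor hx ⟨hθ, fun h => absurd h hs⟩)
  rw [heq]
  refine (MeasurableSet.iUnion fun q => ?_).union
    ((hreg.isCompact_setOf_exists_le hr).isClosed.measurableSet.compl.inter
      (MeasurableSet.const _))
  exact (hreg.isCompact_setOf_le hr hc hx _).isClosed.measurableSet

theorem IsRegularRate.continuous_left (hreg : IsRegularRate Θ Sinf I)
    {θ : EuclideanSpace ℝ (Fin d)} (hθ : θ ∈ Θ) : Continuous fun s => I s θ := by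
  rw [← continuousOn_univ]
  exact hreg.continuousOn.comp (Continuous.prodMk_left θ).continuousOn fun s _ => ⟨mem_univ s, hθ⟩

/-- By `radial`, a nearly worst model in `closure Θ` can be approximated by one in `Θ` of rate
strictly below `r`. Change of measure needs both properties, and `I` is continuous in `s` at models
of `Θ`. -/
theorem IsRegularRate.exists_rate_lt (hreg : IsRegularRate Θ Sinf I) (hr : 0 < r)
    (hc : IsRegularCost X Θ c) {x : EuclideanSpace ℝ (Fin n)} (hx : x ∈ X) {s : 𝕊}
    (hs : s ∈ range Sinf) (hne : ∃ θ ∈ closure Θ, I s θ ≤ ENNReal.ofReal r) {a : ℝ}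
    (ha : a < robustPredictor X Θ c I r x s) :
    ∃ θ ∈ Θ, I s θ < ENNReal.ofReal r ∧ a < c x θ := by
  obtain ⟨θ, hθ, hlt⟩ := exists_lt_costExt_of_lt_robustPredictor
    (closure_nonempty_iff.1 (hne.imp fun _ h => h.1)) ha
  have hmem : θ ∈ closure {θ | θ ∈ Θ ∧ I s θ < ENNReal.ofReal r} := by
    rw [hreg.radial s hs r hr]
    exact ⟨hθ.1, hθ.2 hne⟩
  have hev : ∀ᶠ θ' in 𝓝[{θ | θ ∈ Θ ∧ I s θ < ENNReal.ofReal r}] θ, a < costExt X Θ c x θ' :=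
    ((hc.continuousOn_costExt hx θ hθ.1).mono fun θ' h => subset_closure h.1)
      (lt_mem_nhds hlt)
  have := mem_closure_iff_nhdsWithin_neBot.1 hmem
  obtain ⟨θ', hθ', h1, h2⟩ := (hev.and self_mem_nhdsWithin).exists
  exact ⟨θ', h1, h2, by rwa [hc.costExt_eq hx h1] at hθ'⟩

/-- From below, a model of rate strictly less than `r` stays admissible for nearby statistics. From
above, the compact superlevel sets are closed, and `θ` itself keeps the nearby balls non-empty. -/
theorem IsRegularRate.continuousAt_robustPredictor (hreg : IsRegularRate Θ Sinf I) (hr : 0 < r)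
    (hc : IsRegularCost X Θ c) {x : EuclideanSpace ℝ (Fin n)} (hx : x ∈ X) (θ : Θ)
    (h0 : I (Sinf θ) θ = 0) : ContinuousAt (robustPredictor X Θ c I r x) (Sinf θ) := by
  have hΘ : Θ.Nonempty := ⟨θ, θ.2⟩
  have hr' : 0 < ENNReal.ofReal r := ENNReal.ofReal_pos.2 hr
  have hlt0 : I (Sinf θ) θ < ENNReal.ofReal r := by rwa [h0]
  refine tendsto_order.2 ⟨fun a ha => ?_, fun a ha => ?_⟩
  · obtain ⟨θ', hθ', hI', ha'⟩ := hreg.exists_rate_lt hr hc hx (mem_range_self θ)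
      ⟨θ, subset_closure θ.2, hlt0.le⟩ ha
    filter_upwards [(hreg.continuous_left hθ').continuousAt.eventually_lt_const hI'] with s hs
    rw [← hc.costExt_eq hx hθ'] at ha'
    exact ha'.trans_le (hc.le_robustPredictor hx ⟨subset_closure hθ', fun _ => hs.le⟩)
  · obtain ⟨b, hb, hba⟩ := exists_between ha
    have hopen := (hreg.isCompact_setOf_le hr.le hc hx b).isClosed.isOpen_compl
    have hmem : Sinf θ ∈ {s : 𝕊 | ∃ θ ∈ closure Θ, I s θ ≤ ENNReal.ofReal r ∧
        b ≤ costExt X Θ c x θ}ᶜ := by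
      rintro ⟨θ', hθ', hI', hb'⟩
      exact absurd (hb'.trans (hc.le_robustPredictor hx ⟨hθ', fun _ => hI'⟩)) (not_le.2 hb)
    filter_upwards [hopen.mem_nhds hmem,
      (hreg.continuous_left θ.2).continuousAt.eventually_lt_const hlt0] with s hs hs0
    refine (robustPredictor_le hΘ fun θ' hθ' => ?_).trans_lt hba
    by_contra! hlt
    exact hs ⟨θ', hθ'.1, hθ'.2 ⟨θ, subset_closure θ.2, hs0.le⟩, hlt.le⟩

/-- Pointwise continuity of an equicontinuous family over a compact index set is uniform. -/
theorem IsRegularRate.eventually_forall_robustPredictor_sub_le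
    (hreg : IsRegularRate Θ Sinf I) (hr : 0 < r) (hX : IsCompact X)
    (hc : IsRegularCost X Θ c) (θ : Θ) (h0 : I (Sinf θ) θ = 0) {ε : ℝ} (hε : 0 < ε) :
    ∀ᶠ s in 𝓝 (Sinf θ), ∀ x ∈ X,
      |robustPredictor X Θ c I r x s - robustPredictor X Θ c I r x (Sinf θ)| ≤ ε := by
  -- Two thirds of `ε` pay for replacing `x` by a net point, at `s` and at `Sinf θ`; one third pays
  -- for moving the statistic.
  obtain ⟨δ, hδ, h⟩ := hc.robustPredictor_equicontinuous ⟨θ, θ.2⟩ I r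
    (show 0 < ε / 3 by positivity)
  obtain ⟨t, htX, htf, ht⟩ := hX.finite_cover_balls hδ
  have hev : ∀ᶠ s in 𝓝 (Sinf θ), ∀ y ∈ t,
      |robustPredictor X Θ c I r y s - robustPredictor X Θ c I r y (Sinf θ)| < ε / 3 := by
    rw [eventually_all_finite htf]
    intro y hy
    have hcont := hreg.continuousAt_robustPredictor hr hc (htX hy) θ h0
    exact Metric.tendsto_nhds.1 hcont (ε / 3) (by positivity)
  filter_upwards [hev] with s hs x hx
  obtain ⟨y, hy, hxy⟩ := mem_iUnion₂.1 (ht hx)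
  have h1 := abs_le.1 (h x hx y (htX hy) hxy s)
  have h2 := abs_le.1 (h x hx y (htX hy) hxy (Sinf θ))
  have h3 := abs_lt.1 (hs y hy)
  exact abs_le.2 ⟨by linarith, by linarith⟩

/-- Testing each minimiser in the other problem shows that minimal values differ by at most the
uniform distance of the objectives, even where the minimiser jumps. -/
theorem IsRobustPrescriptor.continuousAt_value (hreg : IsRegularRate Θ Sinf I) (hr : 0 < r)
    (hX : IsCompact X) (hc : IsRegularCost X Θ c) {xt : 𝕊 → EuclideanSpace ℝ (Fin n)}
    (hxt : IsRobustPrescriptor X Θ c Sinf I r xt) (θ : Θ) (h0 : I (Sinf θ) θ = 0) :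
    ContinuousAt (fun s => robustPredictor X Θ c I r (xt s) s) (Sinf θ) := by
  refine Metric.tendsto_nhds.2 fun ε hε => ?_
  filter_upwards [hreg.eventually_forall_robustPredictor_sub_le hr hX hc θ h0
    (half_pos hε)] with s hs
  have h1 := hxt.isMin s (hxt.mem (Sinf θ))
  have h2 := hxt.isMin (Sinf θ) (hxt.mem s)
  have h3 := abs_le.1 (hs _ (hxt.mem s))
  have h4 := abs_le.1 (hs _ (hxt.mem (Sinf θ)))
  simp only [mem_ofPred_eq] at h1 h2
  exact abs_lt.2 ⟨by linarith, by linarith⟩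

theorem continuous_robustPredictor_limit (hreg : IsRegularRate Θ Sinf I) (hr : 0 < r)
    (hc : IsRegularCost X Θ c) (hSinf : Continuous Sinf)
    (h0 : ∀ θ : Θ, I (Sinf θ) θ = 0) :
    Continuous (Function.uncurry fun (x : X) (θ : Θ) =>
      robustPredictor X Θ c I r x (Sinf θ)) := by
  refine continuous_iff_continuousAt.2 fun ⟨x, θ⟩ => Metric.tendsto_nhds.2 fun ε hε => ?_
  obtain ⟨δ, hδ, h⟩ := hc.robustPredictor_equicontinuous ⟨θ, θ.2⟩ I r (half_pos hε)
  have h1 := (hreg.continuousAt_robustPredictor hr hc x.2 θ (h0 θ)).comp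
    (f := Sinf) hSinf.continuousAt
  have h2 := Metric.tendsto_nhds.1 h1 (ε / 2) (half_pos hε)
  rw [nhds_prod_eq]
  filter_upwards [prod_mem_prod (Metric.ball_mem_nhds x hδ) h2] with p hp
  have h3 := h p.1 p.1.2 x x.2 hp.1 (Sinf p.2)
  have h4 : dist _ _ < ε / 2 := hp.2
  rw [Real.dist_eq] at h4 ⊢
  simp only [Function.comp, Function.uncurry] at h4 ⊢
  have h3 := abs_le.1 h3
  have h4 := abs_lt.1 h4
  exact abs_lt.2 ⟨by linarith, by linarith⟩

end Robust

/-! ### Data-driven pairs: measurability, limits, feasibility and the lower bound -/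

section Pairs

variable {X : Set (EuclideanSpace ℝ (Fin n))} {Θ : Set (EuclideanSpace ℝ (Fin d))}
  {P : EuclideanSpace ℝ (Fin d) → Measure Ω} {ξ : ℕ → Ω → EuclideanSpace ℝ (Fin m)}
  {c : EuclideanSpace ℝ (Fin n) → EuclideanSpace ℝ (Fin d) → ℝ}
  {𝕊 : Set (EuclideanSpace ℝ (Fin d))} {S : ℕ → Ω → 𝕊} {Sinf : Θ → 𝕊}
  {I : 𝕊 → EuclideanSpace ℝ (Fin d) → ℝ≥0∞} {r : ℝ}
  {ch : ℕ → EuclideanSpace ℝ (Fin n) → Ω → ℝ} {xh : ℕ → Ω → EuclideanSpace ℝ (Fin n)}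

theorem sInf_image_eq_of_isMinOn {E : Type*} {f : E → ℝ} {A : Set E} {x : E} (hx : x ∈ A)
    (h : IsMinOn f A x) : sInf (f '' A) = f x := by
  refine IsLeast.csInf_eq ⟨mem_image_of_mem f hx, ?_⟩
  rintro _ ⟨y, hy, rfl⟩
  exact h hy

/-- Being below `a` is an open condition, hence is witnessed in a dense set. With a countable one,
the optimal value is measurable although the predictor is assumed measurable only for each fixed
decision. -/
theorem isMinOn_lt_iff_exists_mem_dense {E : Type*} [TopologicalSpace E] {f : E → ℝ} {A : Set E}
    {x : E} (hf : ContinuousOn f A) (hx : x ∈ A) (h : IsMinOn f A x) {D : Set A} (hD : Dense D)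
    (a : ℝ) : f x < a ↔ ∃ y ∈ D, f y < a := by
  constructor
  · intro hlt
    have ho : IsOpen {y : A | f y < a} :=
      isOpen_lt (continuousOn_iff_continuous_domRestrict.1 hf) continuous_const
    obtain ⟨y, hy, hyD⟩ := hD.inter_open_nonempty _ ho ⟨⟨x, hx⟩, hlt⟩
    exact ⟨y, hyD, hy⟩
  · rintro ⟨y, -, hy⟩
    exact lt_of_le_of_lt (h y.2) hy

theorem IsPair.measurable_value (h : IsPair X Θ P ξ ch xh) {T : ℕ} (hT : 1 ≤ T) :
    Measurable[history ξ T] fun ω => ch T (xh T ω) ω := by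
  obtain ⟨D, hDc, hD⟩ := TopologicalSpace.exists_countable_dense X
  refine measurable_of_Iio fun a => ?_
  have heq : (fun ω => ch T (xh T ω) ω) ⁻¹' Iio a = ⋃ y ∈ D, ch T y ⁻¹' Iio a := by
    ext ω
    simp only [mem_preimage, mem_Iio, mem_iUnion, exists_prop]
    exact isMinOn_lt_iff_exists_mem_dense (h.predictor.continuous T hT ω) (h.mem T hT ω)
      (h.induced T hT ω) hD a
  rw [heq]
  exact MeasurableSet.biUnion hDc fun y _ => h.predictor.adapted T hT y y.2 measurableSet_Iio

/-- The exceptional null set may depend on the decision. A countable dense set and continuity give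
one null set for all decisions, so a random decision can be inserted. -/
theorem IsPredictor.exists_dominating (h : IsPredictor X Θ P ξ ch) :
    ∃ cbar : Ω → ℝ, (∀ θ ∈ Θ, Integrable cbar (P θ)) ∧
      ∀ T, 1 ≤ T → ∀ θ ∈ Θ, ∀ᵐ ω ∂(P θ), ∀ x ∈ X, |ch T x ω| ≤ cbar ω := by
  obtain ⟨cbar, -, -, hint, hle⟩ := h.dominated
  refine ⟨cbar, hint, fun T hT θ hθ => ?_⟩
  obtain ⟨D, hDc, hD⟩ := TopologicalSpace.exists_countable_dense X
  have hae : ∀ᵐ ω ∂(P θ), ∀ y ∈ D, |ch T y ω| ≤ cbar ω :=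
    (ae_ball_iff hDc).2 fun y _ => hle T hT y y.2 θ hθ
  filter_upwards [hae] with ω hω x hx
  have hclosed : IsClosed {y : X | |ch T y ω| ≤ cbar ω} :=
    isClosed_le (continuousOn_iff_continuous_domRestrict.1 (h.continuous T hT ω)).abs
      continuous_const
  exact hclosed.closure_subset_iff.2 hω (hD ⟨x, hx⟩)

/-- The expected in-sample risk of a pair converges to the limit in probability of the optimal
values. -/
theorem IsPair.hasAsymptoticRisk (h : IsPair X Θ P ξ ch xh)
    (hξ : ∀ t, 1 ≤ t → Measurable (ξ t)) (hP : IsParametrized Θ P)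
    {θ : EuclideanSpace ℝ (Fin d)} (hθ : θ ∈ Θ) {v : ℝ}
    (hv : TendstoInMeasure (P θ) (fun T ω => ch T (xh T ω) ω) atTop fun _ => v) :
    HasAsymptoticRisk P ch xh θ v := by
  obtain ⟨cbar, hint, hle⟩ := h.predictor.exists_dominating
  have hmeas : ∀ T, 1 ≤ T → AEStronglyMeasurable (fun ω => ch T (xh T ω) ω) (P θ) := fun T hT =>
    ((h.measurable_value hT).mono (history_le hξ T) le_rfl).aestronglyMeasurable
  have hbound : ∀ T, 1 ≤ T → ∀ᵐ ω ∂(P θ), ‖ch T (xh T ω) ω‖ ≤ cbar ω := fun T hT =>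
    (hle T hT θ hθ).mono fun ω hω => hω _ (h.mem T hT ω)
  refine ⟨fun T hT => (hint θ hθ).mono' (hmeas T hT) (hbound T hT), ?_⟩
  -- Convergence in probability is almost sure only along subsequences, so dominated convergence is
  -- applied to a further subsequence of each one.
  refine tendsto_of_subseq_tendsto fun ns hns => ?_
  have hsub : TendstoInMeasure (P θ) (fun k ω => ch (ns k) (xh (ns k) ω) ω) atTop fun _ => v :=
    fun ε hε => (hv ε hε).comp hns
  obtain ⟨ms, hms, hae⟩ := hsub.exists_seq_tendsto_ae
  have hev : ∀ᶠ k in atTop, 1 ≤ ns (ms k) :=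
    (hns.comp hms.tendsto_atTop).eventually_ge_atTop 1
  have := hP.prob θ hθ
  refine ⟨ms, ?_⟩
  have hlim := tendsto_integral_filter_of_dominated_convergence cbar
    (hev.mono fun k hk => hmeas _ hk) (hev.mono fun k hk => hbound _ hk) (hint θ hθ) hae
  simpa using hlim

theorem IsPair.exists_tendstoInMeasure_value (h : IsPair X Θ P ξ ch xh) (θ : Θ) :
    ∃ v : ℝ, TendstoInMeasure (P θ) (fun T ω => ch T (xh T ω) ω) atTop fun _ => v := by
  obtain ⟨vinf, -, hv⟩ := h.predictor.tendsto_value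
  refine ⟨vinf θ, fun ε hε => (hv θ ε hε).congr' ?_⟩
  filter_upwards [eventually_ge_atTop 1] with T hT
  simp only [sInf_image_eq_of_isMinOn (h.mem T hT _) (h.induced T hT _)]

theorem IsRegularCost.continuousOn_left (hc : IsRegularCost X Θ c)
    {θ : EuclideanSpace ℝ (Fin d)} (hθ : θ ∈ Θ) : ContinuousOn (fun x => c x θ) X :=
  hc.unifCont.continuousOn.comp (f := fun x => (x, θ)) (Continuous.prodMk_left θ).continuousOn
    fun _ hx => ⟨hx, hθ⟩

theorem IsPair.measurableSet_disappointment (h : IsPair X Θ P ξ ch xh)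
    (hc : IsRegularCost X Θ c) {θ : EuclideanSpace ℝ (Fin d)} (hθ : θ ∈ Θ) {T : ℕ}
    (hT : 1 ≤ T) : MeasurableSet[history ξ T] {ω | ch T (xh T ω) ω < c (xh T ω) θ} := by
  have hcont : Continuous fun x : X => c x θ :=
    continuousOn_iff_continuous_domRestrict.1 (hc.continuousOn_left hθ)
  -- The cost is continuous only on `X`, so the decision is viewed in the subtype.
  have hx : Measurable[history ξ T] fun ω => (⟨xh T ω, h.mem T hT ω⟩ : X) :=
    (h.adapted T hT).subtype_mk
  exact measurableSet_lt (h.measurable_value hT)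
    (hcont.measurable.comp hx)

/-- The robust predictor and prescriptor form a data-driven pair. -/
theorem isPair_robust (hX : IsCompact X) (hP : IsParametrized Θ P)
    (hc : IsRegularCost X Θ c) (hξ : ∀ t, 1 ≤ t → Measurable (ξ t))
    (hS : IsStatistic Θ P ξ 𝕊 S Sinf) (hI : IsConjugateOn Θ P S I)
    (hreg : IsRegularRate Θ Sinf I) (hΘ : Θ.Nonempty) (hr : 0 < r)
    {xt : 𝕊 → EuclideanSpace ℝ (Fin n)} (hxt : IsRobustPrescriptor X Θ c Sinf I r xt) :
    IsPair X Θ P ξ (fun T x ω => robustPredictor X Θ c I r x (S T ω))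
      (fun T ω => xt (S T ω)) where
  predictor :=
    { continuous := fun T _ ω x hx => by
        refine Metric.tendsto_nhds.2 fun ε hε => ?_
        obtain ⟨δ, hδ, h⟩ := hc.robustPredictor_equicontinuous hΘ I r (half_pos hε)
        filter_upwards [mem_nhdsWithin_of_mem_nhds (Metric.ball_mem_nhds x hδ),
          self_mem_nhdsWithin] with y hy hyX
        exact (h y hyX x hx hy (S T ω)).trans_lt (half_lt_self hε)
      adapted := fun T hT x hx =>
        (hreg.measurable_robustPredictor hr.le hc hΘ hx).comp (hS.adapted T hT)
      dominated := by
        obtain ⟨M, hM0, hM⟩ := hc.exists_abs_robustPredictor_le hΘ I r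
        refine ⟨fun _ => M, measurable_const, fun _ => hM0, fun θ hθ => ?_,
          fun T _ x hx θ _ => ae_of_all _ fun ω => hM x hx (S T ω)⟩
        have := hP.prob θ hθ
        exact integrable_const M
      tendsto_objective :=
        ⟨fun x θ => robustPredictor X Θ c I r x (Sinf θ),
          (continuous_robustPredictor_limit hreg hr hc hS.localHomeo.continuous
            (hI.rate_limit_eq_zero hP hξ hS)).measurable,
          fun x θ => TendstoInMeasure.comp_continuousAt (hS.tendsto θ)
            (hreg.continuousAt_robustPredictor hr hc x.2 θ
              (hI.rate_limit_eq_zero hP hξ hS θ))⟩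
      tendsto_value := by
        refine ⟨fun θ => robustPredictor X Θ c I r (xt (Sinf θ)) (Sinf θ), ?_, fun θ => ?_⟩
        · refine Continuous.measurable (continuous_iff_continuousAt.2 fun θ => ?_)
          exact (hxt.continuousAt_value hreg hr hX hc θ
            (hI.rate_limit_eq_zero hP hξ hS θ)).comp (f := Sinf)
            hS.localHomeo.continuous.continuousAt
        · simp only [fun s => sInf_image_eq_of_isMinOn (hxt.mem s) (hxt.isMin s)]
          exact TendstoInMeasure.comp_continuousAt (hS.tendsto θ)
            (hxt.continuousAt_value hreg hr hX hc θ (hI.rate_limit_eq_zero hP hξ hS θ)) }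
  adapted := fun T hT => hxt.measurable.comp (hS.adapted T hT)
  mem := fun T _ ω => hxt.mem (S T ω)
  induced := fun T _ ω => hxt.isMin (S T ω)

/-- The disappointment of the robust pair decays at rate at least `r`. -/
theorem isFeasible_robust (hX : IsCompact X) (hP : IsParametrized Θ P)
    (hc : IsRegularCost X Θ c) (hξ : ∀ t, 1 ≤ t → Measurable (ξ t))
    (hS : IsStatistic Θ P ξ 𝕊 S Sinf) (hI : IsConjugateOn Θ P S I)
    (hreg : IsRegularRate Θ Sinf I) (hΘ : Θ.Nonempty) (hr : 0 < r)
    {xt : 𝕊 → EuclideanSpace ℝ (Fin n)} (hxt : IsRobustPrescriptor X Θ c Sinf I r xt) :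
    IsFeasible X Θ P ξ c r (fun T x ω => robustPredictor X Θ c I r x (S T ω))
      (fun T ω => xt (S T ω)) where
  pair := isPair_robust hX hP hc hξ hS hI hreg hΘ hr hxt
  rate := fun θ hθ => by
    -- Restricting to non-empty balls supplies the compactness that the large deviation bound
    -- requires.
    have hK := (hreg.isCompact_setOf_exists_le hr.le).inter_right
      (isClosed_le continuous_const (hreg.continuous_left hθ) :
        IsClosed {s | ENNReal.ofReal r ≤ I s θ})
    refine (expGrowthSup_le_of_le fun T => measure_mono fun ω hω => ?_).trans
      (expGrowthSup_measure_le_of_isCompact hξ hS hI hθ hK fun s hs => hs.2)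
    -- Outside the compact set either the ball is empty, and the supremum runs over all models, or
    -- `θ` lies in the ball; neither allows disappointment.
    by_contra hnot
    refine absurd (show robustPredictor X Θ c I r (xt (S T ω)) (S T ω) < c (xt (S T ω)) θ from hω)
      (not_lt.2 ?_)
    rw [← hc.costExt_eq (hxt.mem _) hθ]
    refine hc.le_robustPredictor (hxt.mem _) ⟨subset_closure hθ, fun hne => ?_⟩
    by_contra! hlt
    exact hnot ⟨hne, hlt.le⟩

/-- No feasible pair has optimal values whose limit is below the robust value. -/
theorem IsFeasible.le_of_tendstoInMeasure (h : IsFeasible X Θ P ξ c r ch xh) (hX : IsCompact X)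
    (hP : IsParametrized Θ P) (hc : IsRegularCost X Θ c)
    (hξ : ∀ t, 1 ≤ t → Measurable (ξ t)) (hS : IsStatistic Θ P ξ 𝕊 S Sinf)
    (hexp : IsExponentialFamily Θ P ξ S) (hGE : GartnerEllis Θ P S)
    (hI : IsConjugateOn Θ P S I) (hreg : IsRegularRate Θ Sinf I) (hr : 0 < r) (θ : Θ) {v w : ℝ}
    (hv : TendstoInMeasure (P θ) (fun T ω => ch T (xh T ω) ω) atTop fun _ => v)
    (hw : ∀ x ∈ X, w ≤ robustPredictor X Θ c I r x (Sinf θ)) : w ≤ v := by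
  by_contra! hlt
  obtain ⟨b, hvb, hbw⟩ := exists_between hlt
  have h0 : I (Sinf θ) θ = 0 := hI.rate_limit_eq_zero hP hξ hS θ
  have hlow : Tendsto (fun T => P θ {ω | ch T (xh T ω) ω < b ∧ xh T ω ∈ X}) atTop (𝓝 0) := by
    refine hX.induction_on (p := fun Y =>
      Tendsto (fun T => P θ {ω | ch T (xh T ω) ω < b ∧ xh T ω ∈ Y}) atTop (𝓝 0)) ?_ ?_ ?_ ?_
    · simp
    · exact fun s t hst ht => tendsto_of_tendsto_of_tendsto_of_le_of_le tendsto_const_nhds ht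
        (fun _ => zero_le) fun T => measure_mono fun ω hω => ⟨hω.1, hst hω.2⟩
    · intro s t hs ht
      have hst := hs.add ht
      rw [add_zero] at hst
      refine tendsto_of_tendsto_of_tendsto_of_le_of_le tendsto_const_nhds hst
        (fun _ => zero_le) fun T => (measure_mono fun ω hω => ?_).trans (measure_union_le _ _)
      exact hω.2.imp (fun h' => ⟨hω.1, h'⟩) fun h' => ⟨hω.1, h'⟩
    · intro x hx
      obtain ⟨θ', hθ', hI', hb⟩ := hreg.exists_rate_lt hr hc hx (mem_range_self θ)
        ⟨θ, subset_closure θ.2, by simp [h0]⟩ (hbw.trans_le (hw x hx))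
      -- For decisions in this neighbourhood, a value below `b` lies below the cost under `θ'`, so
      -- the event is contained in the disappointment event of `θ'`.
      refine ⟨{x' | b < c x' θ'}, hc.continuousOn_left hθ' x hx (lt_mem_nhds hb), ?_⟩
      have hzero := tendsto_measure_zero_of_expGrowthSup_le hexp hP hξ hS hGE hI hθ' θ hI'
        (fun T hT => h.pair.measurableSet_disappointment hc hθ' hT) (h.rate θ' hθ')
      exact tendsto_of_tendsto_of_tendsto_of_le_of_le tendsto_const_nhds hzero
        (fun _ => zero_le) fun T => measure_mono fun ω hω => lt_trans hω.1 hω.2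
  have hhigh := tendsto_measure_of_tendstoInMeasure_const hv (Iio_mem_nhds hvb)
  have hsum := hlow.add hhigh
  rw [add_zero] at hsum
  have := hP.prob θ θ.2
  have hone : (1 : ℝ≥0∞) ≤ 0 := by
    refine ge_of_tendsto hsum ?_
    filter_upwards [eventually_ge_atTop 1] with T hT
    rw [← measure_univ (μ := P θ)]
    refine (measure_mono fun ω _ => ?_).trans (measure_union_le _ _)
    by_cases hω : ch T (xh T ω) ω < b
    · exact Or.inl ⟨hω, h.pair.mem T hT ω⟩
    · exact Or.inr hω
  exact absurd hone (by simp)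

end Pairs

end DataDriven

/-! ### Pareto dominance -/

theorem mainTheorem4 {d n m : ℕ} {Ω : Type*} [MeasurableSpace Ω]
    (X : Set (EuclideanSpace ℝ (Fin n))) (hX : IsCompact X)
    (Θ : Set (EuclideanSpace ℝ (Fin d))) (P : EuclideanSpace ℝ (Fin d) → Measure Ω)
    (hP : DataDriven.IsParametrized Θ P)
    (c : EuclideanSpace ℝ (Fin n) → EuclideanSpace ℝ (Fin d) → ℝ)
    (hc : DataDriven.IsRegularCost X Θ c)
    (ξ : ℕ → Ω → EuclideanSpace ℝ (Fin m)) (hξ : ∀ t, 1 ≤ t → Measurable (ξ t))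
    (𝕊 : Set (EuclideanSpace ℝ (Fin d))) (S : ℕ → Ω → 𝕊) (Sinf : Θ → 𝕊)
    (hS : DataDriven.IsStatistic Θ P ξ 𝕊 S Sinf)
    (hexp : DataDriven.IsExponentialFamily Θ P ξ S)
    (hGE : DataDriven.GartnerEllis Θ P S)
    (I : 𝕊 → EuclideanSpace ℝ (Fin d) → ℝ≥0∞)
    (hI : DataDriven.IsConjugateOn Θ P S I)
    (hreg : DataDriven.IsRegularRate Θ Sinf I)
    (r : ℝ) (hr : 0 < r)
    (xt : 𝕊 → EuclideanSpace ℝ (Fin n))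
    (hxt : DataDriven.IsRobustPrescriptor X Θ c Sinf I r xt) :
    DataDriven.IsParetoDominant X Θ P ξ c r
      (fun T x ω => DataDriven.robustPredictor X Θ c I r x (S T ω))
      (fun T ω => xt (S T ω)) := by
  have hΘ : Θ.Nonempty := hexp.imp fun _ h => h.1
  have hfeas := DataDriven.isFeasible_robust hX hP hc hξ hS hI hreg hΘ hr hxt
  refine ⟨hfeas, fun ch' xh' h' θ hθ => ?_⟩
  have hvalue := DataDriven.TendstoInMeasure.comp_continuousAt (hS.tendsto ⟨θ, hθ⟩)
    (hxt.continuousAt_value hreg hr hX hc ⟨θ, hθ⟩ (hI.rate_limit_eq_zero hP hξ hS ⟨θ, hθ⟩))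
  obtain ⟨v', hv'⟩ := h'.pair.exists_tendstoInMeasure_value ⟨θ, hθ⟩
  exact ⟨_, v', hfeas.pair.hasAsymptoticRisk hξ hP hθ hvalue,
    h'.pair.hasAsymptoticRisk hξ hP hθ hv',
    h'.le_of_tendstoInMeasure hX hP hc hξ hS hexp hGE hI hreg hr ⟨θ, hθ⟩ hv'
      fun x hx => hxt.isMin (Sinf ⟨θ, hθ⟩) hx⟩
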